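/- Let $q,c\in\mathbb{C}$ with $0<|q|<1$, and let $\mathcal{D}_{q,c}g(z)=\frac{g(qz+c)-g(z)}{(q-1)z+c}$ be the Hahn difference operator. Let $g$ be a non-constant meromorphic function on $\mathbb{C}$ with Nevanlinna characteristic $T(r,g)$ and order zero, i.e. $\limsup_{r\to\infty}\frac{\log^+T(r,g)}{\log r}=0$. For $a\in\mathbb{C}\cup\{\infty\}$ let $\hat n_{q,c}(r,g=a)$ be the sum of $n-\min\{n,m'\}$ over all points $z$ with $|z|\le r$ at which $g(z)=a$, where $n$ is the multiplicity with which $g$ takes the value $a$ at $z$, and $m'\ge 0$ is the multiplicity of $z$ as a zero of $\mathcal{D}_{q,c}g$ if $a\in\mathbb{C}$, and as a zero of $\mathcal{D}_{q,c}(1/g)$ if $a=\infty$ (so $m'=0$ if $z$ is not a zero). Put $$\hat N_{q,c}(r,g=a)=\int_0^r\frac{\hat n_{q,c}(t,g=a)-\hat n_{q,c}(0,g=a)}{t}\,dt+\hat n_{q,c}(0,g=a)\log r,$$ $$\Theta_{q,c}(a,g)=1-\limsup_{r\to\infty}\frac{\hat N_{q,c}(r,g=a)}{T(r,g)}.$$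 Call $a$ a Hahn-Nevanlinna deficient value of $g$ if $\Theta_{q,c}(a,g)>0$. Then $g$ has at most countably many Hahn-Nevanlinna deficient values $a\in\mathbb{C}\cup\{\infty\}$. -/

import Mathlib

open Filter

namespace HahnNevanlinna

noncomputable section

/-- The Hahn difference operator `D_{q,c} g (z) = (g(qz+c) - g(z)) / ((q-1)z + c)`.
As for every meromorphic function below, its values on a discrete set (here the fixed point of
`z ↦ qz + c` and the poles) play no role: only its orders at points are used. -/
def hahnDiff (q c : ℂ) (g : ℂ → ℂ) : ℂ → ℂ :=
  fun z ↦ (g (q * z + c) - g z) / ((q - 1) * z + c)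

/-- Multiplicity of `z` as a zero of the meromorphic function `f`: the order of `f` at `z` if this
is positive, `0` if `f` has a pole or a nonzero value at `z`, and `⊤` if `f` vanishes identically
near `z`. -/
def zeroMult (f : ℂ → ℂ) (z : ℂ) : ℕ∞ :=
  WithTop.map Int.toNat (meromorphicOrderAt f z)

/-- `n - min(n, m')`, where `n` and `m'` are the multiplicities of `z` as a zero of `f` and of
`h`. -/
def reducedMult (f h : ℂ → ℂ) (z : ℂ) : ℕ :=
  (zeroMult f z - min (zeroMult f z) (zeroMult h z)).toNat

/-- The contribution of the point `z` to the Hahn-type counting function of the value `a`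
(`a = ⊤` is the value `∞`): `n - min(n, m')`, where `n` is the multiplicity with which
`g(z) = a`, and `m'` is the zero multiplicity at `z` of `D_{q,c} g` if `a` is finite, and of
`D_{q,c} (1/g)` if `a = ∞`. -/
def hahnMult (q c : ℂ) (g : ℂ → ℂ) : WithTop ℂ → ℂ → ℕ
  | ⊤ => reducedMult (fun z ↦ (g z)⁻¹) (hahnDiff q c fun z ↦ (g z)⁻¹)
  | (b : ℂ) => reducedMult (fun z ↦ g z - b) (hahnDiff q c g)

/-- The Hahn-type counting function `n̂_{q,c}(r, g = a)`. We count in `|z| ≤ r`, so that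
the value at `r = 0` is the contribution of the origin; counting in `|z| < r` for `r > 0` changes
this for a discrete set of radii only, and does not affect the integrated counting function. -/
def hahnCount (q c : ℂ) (g : ℂ → ℂ) (a : WithTop ℂ) (r : ℝ) : ℕ :=
  ∑ᶠ z ∈ Metric.closedBall (0 : ℂ) r, hahnMult q c g a z

/-- The integrated Hahn-type counting function `N̂_{q,c}(r, g = a)`. -/
def hahnLogCount (q c : ℂ) (g : ℂ → ℂ) (a : WithTop ℂ) (r : ℝ) : ℝ :=
  (∫ t in (0 : ℝ)..r, ((hahnCount q c g a t : ℝ) - (hahnCount q c g a 0 : ℝ)) / t) +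
    (hahnCount q c g a 0 : ℝ) * Real.log r

/-- The Nevanlinna characteristic `T(r, g) = m(r, g) + N(r, g)`. -/
def nevT (g : ℂ → ℂ) (r : ℝ) : ℝ :=
  ValueDistribution.characteristic g ⊤ r

/-- The order of growth `ρ(g) = limsup_{r → ∞} log⁺ T(r, g) / log r`. -/
def growthOrder (g : ℂ → ℂ) : EReal :=
  limsup (fun r : ℝ ↦ ((Real.posLog (nevT g r) / Real.log r : ℝ) : EReal)) atTop

/-- The Hahn-type ramification index
`Θ_{q,c}(a, g) = 1 - limsup_{r → ∞} N̂_{q,c}(r, g = a) / T(r, g)`. -/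
def hahnTheta (q c : ℂ) (g : ℂ → ℂ) (a : WithTop ℂ) : EReal :=
  1 - limsup (fun r : ℝ ↦ ((hahnLogCount q c g a r / nevT g r : ℝ) : EReal)) atTop

/-- `a ∈ ℂ ∪ {∞}` is a Hahn-Nevanlinna deficient value of `g` if `Θ_{q,c}(a, g) > 0`. -/
def IsHahnDeficient (q c : ℂ) (g : ℂ → ℂ) (a : WithTop ℂ) : Prop :=
  0 < hahnTheta q c g a

/-- A meromorphic function, given by a map `ℂ → ℂ` whose values on a discrete set are immaterial,
is constant if the map agrees with a constant outside a closed discrete set. -/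
def IsConstantMeromorphic (g : ℂ → ℂ) : Prop :=
  ∃ b : ℂ, g =ᶠ[codiscrete ℂ] fun _ ↦ b

end

end HahnNevanlinna

namespace HahnNevanlinna

/-! The engine is a weak second main theorem whose main term does not depend on the number of values
tested. Write Δ for `hahnDiff q c g` and T for the characteristic of `g`. A point can be close to
only one value of a finite set `s`, so Σ m(r, 1/(g - a)) ≤ m(r, 1/Δ) + Σ m(r, Δ/(g - a)) + O(1). At
each point at most one g - a vanishes, so Σ N(r, 1/(g - a)) - N(r, 1/Δ) ≤ Σ N̂(r, a). By the first
main theorem for g - a and for Δ, Σ (T - N̂) ≤ T(r, Δ) + Σ m(r, Δ/(g - a)) + O(1), where T(r, Δ) ≤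
3T + m(r, g(qz+c)/g) + O(1).

The remaining proximity functions are small by an analogue of the lemma on the logarithmic
derivative (`proximity_shift_quotient_le`). On |z| ≤ R, log ‖f‖ is the potential of the zeros and
poles plus a harmonic function. Passing from z to qz + c costs a bounded average per zero or pole,
and for the harmonic part O(r/R) times a mean on |z| = R. The zeros and poles in |z| ≤ R number
O(T(kR) / log k) up to a constant, so R = kr with k large gives a bound εT(k²r) + O(1)
(`exists_proximity_shift_le`).

Order zero yields arbitrarily large r with T(Kr) ≤ 2T(r). There, p values with N̂ ≤ (1 - η)T would
give pηT ≤ 5T, which is impossible for p > 6/η. The finite deficient values are thus covered by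
finite sets, one for each η = 1/(n+1), and ∞ is a single further point. -/

open Filter Metric Real Set Function Topology

/-! ### Circle averages of logarithms and a Harnack estimate -/

/-- Circle averages are monotone under inequalities that hold off a finite set. -/
lemma circleAverage_mono_off_finite {F G : ℂ → ℝ} {S : Set ℂ} {r : ℝ} (hS : S.Finite)
    (hr : r ≠ 0) (hF : CircleIntegrable F 0 r) (hG : CircleIntegrable G 0 r)
    (h : ∀ z ∈ sphere (0 : ℂ) |r|, z ∉ S → F z ≤ G z) :
    circleAverage F 0 r ≤ circleAverage G 0 r := by
  classical
  have hFF : F =ᶠ[codiscreteWithin (sphere (0 : ℂ) |r|)] fun z ↦ if z ∈ S then G z else F z := by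
    filter_upwards [compl_finite_mem_codiscreteWithin hS] with z hz
    simp [show z ∉ S from hz]
  rw [circleAverage_congr_codiscreteWithin hFF hr]
  refine circleAverage_mono (hF.congr_codiscreteWithin hFF) hG fun z hz ↦ ?_
  by_cases hzS : z ∈ S
  · simp [hzS]
  · simpa [hzS] using h z hz hzS

/-- A Harnack-type estimate for the difference of two values of a harmonic function. -/
lemma harmonic_sub_le {u : ℂ → ℝ} {r R : ℝ} (κ : ℝ) (hr : 0 < r) (hR : 2 * r ≤ R)
    (hu : InnerProductSpace.HarmonicOnNhd u (closedBall (0 : ℂ) R)) {z w : ℂ}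
    (hz : ‖z‖ ≤ r) (hw : ‖w‖ ≤ r) :
    u w - u z ≤ 6 * r / R * circleAverage (fun ζ ↦ |u ζ + κ|) 0 R := by
  have hR0 : 0 < R := by linarith
  have hball : ∀ x : ℂ, ‖x‖ ≤ r → x ∈ ball (0 : ℂ) R := fun x hx ↦ by
    simp only [mem_ball, dist_zero_right]; linarith
  have hcont : ContinuousOn u (sphere (0 : ℂ) |R|) := by
    rw [abs_of_pos hR0]
    exact fun x hx ↦ (hu x (sphere_subset_closedBall hx)).1.continuousAt.continuousWithinAt
  have hv : InnerProductSpace.HarmonicOnNhd (fun ζ ↦ u ζ + κ) (closedBall (0 : ℂ) R) :=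
    hu.add (InnerProductSpace.harmonicOnNhd_const κ)
  have hvc : ContinuousOn (fun ζ ↦ u ζ + κ) (sphere (0 : ℂ) |R|) := hcont.add continuousOn_const
  have hkc : ∀ x : ℂ, ‖x‖ ≤ r → CircleIntegrable
      ((Complex.re ∘ herglotzRieszKernel 0 x) • fun ζ ↦ u ζ + κ) 0 R := fun x hx ↦ by
    refine ContinuousOn.circleIntegrable' ?_
    exact (Complex.continuous_re.comp_continuousOn
      (continuousOn_herglotzRieszKernel_sphere (hball x hx))).smul hvc
  -- Poisson's formula for u + κ. The constant κ cancels in `u w - u z`, but a good choice of it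
  -- makes the mean of |u + κ| small.
  have e : ∀ x : ℂ, ‖x‖ ≤ r → circleAverage
      ((Complex.re ∘ herglotzRieszKernel 0 x) • fun ζ ↦ u ζ + κ) 0 R = u x + κ := fun x hx ↦
    hv.circleAverage_re_herglotzRieszKernel_smul (hball x hx)
  have hkey : u w - u z = circleAverage
      (fun ζ ↦ ((herglotzRieszKernel 0 w ζ).re - (herglotzRieszKernel 0 z ζ).re) * (u ζ + κ)) 0 R := by
    have := circleAverage_sub (hkc w hw) (hkc z hz)
    rw [e w hw, e z hz] at this
    rw [show u w - u z = u w + κ - (u z + κ) by ring, ← this]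
    congr 1
    ext ζ
    simp
    ring
  rw [hkey, ← smul_eq_mul, ← circleAverage_fun_smul]
  refine circleAverage_mono ?_ ?_ fun ζ hζ ↦ ?_
  · have := (hkc w hw).sub (hkc z hz)
    convert this using 1
    ext ζ
    simp
    ring
  · exact (ContinuousOn.circleIntegrable' (hvc.abs)).const_smul
  · rw [abs_of_pos hR0] at hζ
    have up : ∀ x : ℂ, ‖x‖ ≤ r → (herglotzRieszKernel 0 x ζ).re ≤ (R + r) / (R - r) := fun x hx ↦ by
      have := re_herglotzRieszKernel_le hζ (hball x hx)
      simp only [sub_zero] at this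
      rw [herglotzRieszKernel_def]
      simp only [sub_zero]
      refine this.trans ?_
      gcongr
      linarith
    have lo : ∀ x : ℂ, ‖x‖ ≤ r → (R - r) / (R + r) ≤ (herglotzRieszKernel 0 x ζ).re := fun x hx ↦ by
      have := le_re_herglotzRieszKernel hζ (hball x hx)
      simp only [sub_zero] at this
      rw [herglotzRieszKernel_def]
      simp only [sub_zero]
      refine le_trans ?_ this
      have := norm_nonneg x
      gcongr
      linarith
    -- The left side is 4rR / (R² - r²), and R ≥ 2r gives R² - r² ≥ 3R²/4.
    have hd : (R + r) / (R - r) - (R - r) / (R + r) ≤ 6 * r / R := by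
      rw [div_sub_div _ _ (by linarith) (by linarith), div_le_div_iff₀ (by nlinarith) hR0]
      nlinarith [mul_nonneg hr.le (sub_nonneg.2 hR), mul_pos hr hR0,
        mul_nonneg hr.le (mul_nonneg (sub_nonneg.2 hR) (by linarith : 0 ≤ R + 2 * r))]
    have hab : |(herglotzRieszKernel 0 w ζ).re - (herglotzRieszKernel 0 z ζ).re| ≤ 6 * r / R := by
      rw [abs_le]
      constructor <;> linarith [up w hw, up z hz, lo w hw, lo z hz]
    calc _ ≤ |((herglotzRieszKernel 0 w ζ).re - (herglotzRieszKernel 0 z ζ).re) * (u ζ + κ)| :=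
          le_abs_self _
      _ ≤ _ := by
        rw [abs_mul, smul_eq_mul]
        gcongr

/-- The average over `|z| = r` of `log (r + ‖a‖) - log ‖z - a‖` is at most `log 2`. -/
lemma circleAverage_log_sub_le {r : ℝ} (hr : 0 < r) (a : ℂ) :
    log (r + ‖a‖) - circleAverage (log ‖· - a‖) 0 r ≤ log 2 := by
  rw [circleAverage_log_norm_sub_const_eq_log_radius_add_posLog hr.ne']
  -- The average is log max(r, ‖a‖), and r + ‖a‖ is at most twice this maximum.
  have h : log (r + ‖a‖) ≤ log 2 + (log r + log⁺ (r⁻¹ * ‖0 - a‖)) := by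
    have ha := norm_nonneg a
    rcases le_total ‖a‖ r with h | h
    · have : log (r + ‖a‖) ≤ log (2 * r) := log_le_log (by positivity) (by linarith)
      rw [log_mul (by norm_num) hr.ne'] at this
      have := posLog_nonneg (x := r⁻¹ * ‖0 - a‖)
      linarith
    · have h0 : 0 < ‖a‖ := hr.trans_le h
      have : log (r + ‖a‖) ≤ log (2 * ‖a‖) := log_le_log (by positivity) (by linarith)
      rw [log_mul (by norm_num) h0.ne'] at this
      have h2 : log (r⁻¹ * ‖0 - a‖) ≤ log⁺ (r⁻¹ * ‖0 - a‖) := le_max_right _ _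
      rw [zero_sub, norm_neg, log_mul (by positivity) h0.ne', log_inv] at h2
      rw [zero_sub, norm_neg]
      linarith
  linarith

lemma circleIntegrable_log_norm_affine (q c a : ℂ) (r : ℝ) :
    CircleIntegrable (fun z ↦ log ‖q * z + c - a‖) 0 r := by
  refine MeromorphicOn.circleIntegrable_log_norm fun z _ ↦ ?_
  fun_prop

/-- The average over `|z| = r` of `log (r + ‖a‖) - log ‖q z + c - a‖` is bounded. -/
lemma circleAverage_log_affine_sub_le {q c : ℂ} {r : ℝ} (hq0 : 0 < ‖q‖) (hq1 : ‖q‖ < 1)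
    (hr : 0 < r) (hrc : 2 * ‖c‖ ≤ r) (a : ℂ) :
    log (r + ‖a‖) - circleAverage (fun z ↦ log ‖q * z + c - a‖) 0 r ≤ log (4 / ‖q‖) := by
  have hq : q ≠ 0 := norm_pos_iff.1 hq0
  have hav : circleAverage (fun z ↦ log ‖q * z + c - a‖) 0 r =
      log ‖q‖ + (log r + log⁺ (r⁻¹ * ‖0 - (a - c) / q‖)) := by
    rw [← circleAverage_log_norm_sub_const_eq_log_radius_add_posLog hr.ne']
    rw [← circleAverage_const (log ‖q‖) 0 r, ← circleAverage_fun_add]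
    -- At the zero of qz + c - a the logarithm of the product does not split, because `log 0 = 0`;
    -- that point is discarded.
    · have hfin : ({(a - c) / q} : Set ℂ)ᶜ ∈ codiscreteWithin (sphere (0 : ℂ) |r|) :=
        compl_finite_mem_codiscreteWithin (finite_singleton _)
      refine circleAverage_congr_codiscreteWithin ?_ hr.ne'
      filter_upwards [hfin] with z hz
      have hz' : z - (a - c) / q ≠ 0 := sub_ne_zero.2 hz
      rw [← log_mul hq0.ne' (norm_ne_zero_iff.2 hz'), ← norm_mul]
      congr 2
      field_simp
      ring
    · exact circleIntegrable_const _ _ _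
    · exact circleIntegrable_log_norm_sub_const r
  rw [hav]
  have ha := norm_nonneg a
  have hc := norm_nonneg c
  rcases le_total ‖a‖ r with h | h
  · have h1 : log (r + ‖a‖) ≤ log (4 / ‖q‖ * (‖q‖ * r)) := by
      refine log_le_log (by positivity) ?_
      rw [← mul_assoc, div_mul_cancel₀ _ hq0.ne']
      linarith
    rw [log_mul (by positivity) (by positivity), log_mul hq0.ne' hr.ne'] at h1
    have := posLog_nonneg (x := r⁻¹ * ‖0 - (a - c) / q‖)
    linarith
  · have hac : ‖a‖ - ‖c‖ ≤ ‖a - c‖ := norm_sub_norm_le a c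
    have hac0 : 0 < ‖a - c‖ := by linarith
    have h2 : log (r⁻¹ * ‖0 - (a - c) / q‖) ≤ log⁺ (r⁻¹ * ‖0 - (a - c) / q‖) := le_max_right _ _
    have h3 : log (r⁻¹ * ‖0 - (a - c) / q‖) = - log r + (log ‖a - c‖ - log ‖q‖) := by
      rw [zero_sub, norm_neg, norm_div, log_mul (by positivity) (by positivity), log_inv,
        log_div hac0.ne' hq0.ne']
    -- Here 2‖c‖ ≤ r ≤ ‖a‖, so ‖a - c‖ ≥ ‖a‖/2 and r + ‖a‖ ≤ 4‖a - c‖.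
    have h1 : log (r + ‖a‖) ≤ log (4 / ‖q‖ * ‖a - c‖) := by
      refine log_le_log (by positivity) ?_
      have : r + ‖a‖ ≤ 4 * ‖a - c‖ := by linarith
      refine this.trans ?_
      gcongr
      rw [le_div_iff₀ hq0]
      linarith
    rw [log_mul (by positivity) hac0.ne'] at h1
    linarith

lemma abs_log_eq_posLog_add_posLog_inv (x : ℝ) : |log x| = log⁺ x + log⁺ x⁻¹ := by
  rw [posLog, posLog, log_inv]
  rcases le_total 0 (log x) with h | h
  · rw [abs_of_nonneg h, max_eq_right h, max_eq_left (by linarith)]; ring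
  · rw [abs_of_nonpos h, max_eq_left h, max_eq_right (by linarith)]; ring

/-! ### Proximity function of the shift quotient -/

/-- The number of zeros and poles of `f` in `|z| ≤ R`, with multiplicities. -/
noncomputable def divisorMass (f : ℂ → ℂ) (R : ℝ) : ℝ :=
  ∑ᶠ u, |(MeromorphicOn.divisor f (closedBall (0 : ℂ) R) u : ℝ)|

lemma abs_log_sub_log_le {x y M : ℝ} (hx : x ≤ M) (hy : y ≤ M) :
    |x - y| ≤ (M - x) + (M - y) := by
  rw [abs_le]; constructor <;> linarith

lemma circleIntegrable_log_norm_sub (u : ℂ) (R : ℝ) :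
    CircleIntegrable (fun z ↦ log ‖z - u‖) 0 R :=
  circleIntegrable_log_norm_sub_const R

/-- On a disc, `log ‖f‖` is the sum of the logarithmic potential of the divisor of `f` and of a
harmonic function, off a finite set. -/
lemma exists_harmonic_log_norm {f : ℂ → ℂ} (hf : Meromorphic f)
    (hne : ∀ z, meromorphicOrderAt f z ≠ ⊤) (R : ℝ) :
    ∃ (s : Finset ℂ) (d : ℂ → ℝ) (u : ℂ → ℝ) (S : Set ℂ), S.Finite ∧
      (∀ a ∈ s, ‖a‖ ≤ R) ∧ divisorMass f R = ∑ a ∈ s, |d a| ∧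
      InnerProductSpace.HarmonicOnNhd u (closedBall (0 : ℂ) R) ∧
      ∀ z ∈ closedBall (0 : ℂ) R, z ∉ S → log ‖f z‖ = ∑ a ∈ s, d a * log ‖z - a‖ + u z := by
  have hK := isCompact_closedBall (0 : ℂ) R
  set D := MeromorphicOn.divisor f (closedBall (0 : ℂ) R) with hD
  have hfin : D.support.Finite := D.finiteSupport hK
  obtain ⟨h, h1, h2, h3⟩ := (hf.meromorphicOn (s := closedBall (0 : ℂ) R)).extract_zeros_poles
    (fun u ↦ hne u) hfin
  have h4 := MeromorphicOn.extract_zeros_poles_log h2 h3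
  -- The harmonic part is log ‖h‖ for the zero-free analytic factor h. The identity holds
  -- codiscretely, hence off a finite subset of the compact disc.
  refine ⟨hfin.toFinset, fun a ↦ (D a : ℝ), fun z ↦ log ‖h z‖, _,
    hK.finite_sdiff_of_mem_codiscreteWithin h4, ?_, ?_, ?_, ?_⟩
  · intro a ha
    simpa using D.supportWithinDomain (hfin.mem_toFinset.1 ha)
  · refine finsum_eq_sum_of_support_subset _ fun a ha ↦ ?_
    simpa [hD] using ha
  · exact fun x hx ↦ (h1 x hx).harmonicAt_log_norm (h2 ⟨x, hx⟩)
  · intro z hz hzS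
    have h5 : log ‖f z‖ = (∑ᶠ u, (fun w ↦ (D u : ℝ) * log ‖w - u‖) + fun w ↦ log ‖h w‖) z := by
      by_contra hcon
      exact hzS ⟨hz, hcon⟩
    rw [h5, Pi.add_apply, finsum_eq_sum_of_support_subset (s := hfin.toFinset), Finset.sum_apply]
    intro a ha
    simp only [Set.Finite.coe_toFinset, Function.mem_support]
    intro h0
    apply ha
    ext w
    simp [h0]

lemma circleAverage_abs_log_norm {f : ℂ → ℂ} (hf : Meromorphic f) (R : ℝ) :
    circleAverage (fun z ↦ |log ‖f z‖|) 0 R =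
      ValueDistribution.proximity f ⊤ R + ValueDistribution.proximity f⁻¹ ⊤ R := by
  rw [ValueDistribution.proximity_top, ValueDistribution.proximity_top, ← circleAverage_fun_add
    hf.meromorphicOn.circleIntegrable_posLog_norm hf.inv.meromorphicOn.circleIntegrable_posLog_norm]
  congr 1
  ext z
  simp [abs_log_eq_posLog_add_posLog_inv]

/-- The difference analogue of the estimate of the logarithmic derivative: a bound for the
proximity function of `f (q z + c) / f z`. -/
theorem proximity_shift_quotient_le {f : ℂ → ℂ} (hf : Meromorphic f)
    (hne : ∀ z, meromorphicOrderAt f z ≠ ⊤) {q c : ℂ} (hq0 : 0 < ‖q‖) (hq1 : ‖q‖ < 1)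
    {r R : ℝ} (hr : 0 < r) (hrc : 2 * ‖c‖ ≤ r) (hrq : ‖q‖ * r + ‖c‖ ≤ r) (hR : 2 * r ≤ R) :
    circleAverage (fun z ↦ log⁺ ‖f (q * z + c) / f z‖) 0 r ≤
      divisorMass f R * (log 2 + log (4 / ‖q‖)) +
      6 * r / R * (ValueDistribution.proximity f ⊤ R + ValueDistribution.proximity f⁻¹ ⊤ R
        + divisorMass f R * (2 * log 2)) := by
  have hR0 : 0 < R := by linarith
  have hq : q ≠ 0 := norm_pos_iff.1 hq0
  obtain ⟨s, d, u, S, hS, hsR, hmass, hu, hlog⟩ := exists_harmonic_log_norm hf hne R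
  -- On |z| = R the mean of log ‖z - a‖ is log R for ‖a‖ ≤ R. With this κ, u + κ is log ‖f‖ minus a
  -- potential whose terms have mean zero there.
  set κ : ℝ := ∑ a ∈ s, d a * log R with hκ
  set A : ℝ := circleAverage (fun ζ ↦ |u ζ + κ|) 0 R with hA
  have huc : ContinuousOn u (sphere (0 : ℂ) |R|) := by
    rw [abs_of_pos hR0]
    exact hu.continuousOn.mono sphere_subset_closedBall
  have hA0 : 0 ≤ A := circleAverage_nonneg_of_nonneg fun _ _ ↦ abs_nonneg _
  have i1 : ∀ a : ℂ, CircleIntegrable (fun z ↦ log (2 * R) - log ‖z - a‖) 0 R := fun a ↦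
    (circleIntegrable_const _ _ _).sub (circleIntegrable_log_norm_sub a R)
  have i2 : CircleIntegrable (fun z ↦ |log ‖f z‖|) 0 R :=
    hf.meromorphicOn.circleIntegrable_log_norm.abs
  have i3 : ∀ a ∈ s, CircleIntegrable
      (fun z ↦ |d a| * (log 2 + (log (2 * R) - log ‖z - a‖))) 0 R := fun a _ ↦
    ((circleIntegrable_const _ _ _).add (i1 a)).const_smul (a := |d a|)
  have hAle : A ≤ ValueDistribution.proximity f ⊤ R + ValueDistribution.proximity f⁻¹ ⊤ R
        + divisorMass f R * (2 * log 2) := by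
    calc A ≤ circleAverage (fun z ↦ |log ‖f z‖| +
          ∑ a ∈ s, |d a| * (log 2 + (log (2 * R) - log ‖z - a‖))) 0 R := by
          refine circleAverage_mono_off_finite (hS.union s.finite_toSet) hR0.ne' ?_ ?_ ?_
          · exact ContinuousOn.circleIntegrable' (huc.add continuousOn_const).abs
          · exact i2.add (CircleIntegrable.fun_sum s i3)
          · intro z hz hzS
            rw [abs_of_pos hR0] at hz
            have hzn : ‖z‖ = R := by simpa using hz
            simp only [mem_union, not_or, Finset.mem_coe] at hzS
            have e := hlog z (sphere_subset_closedBall hz) hzS.1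
            have e2 : u z + κ = log ‖f z‖ - ∑ a ∈ s, d a * (log ‖z - a‖ - log R) := by
              rw [e, hκ]
              simp only [mul_sub, Finset.sum_sub_distrib]
              ring
            rw [e2]
            refine (abs_sub _ _).trans ?_
            gcongr
            refine (Finset.abs_sum_le_sum_abs _ _).trans (Finset.sum_le_sum fun a ha ↦ ?_)
            rw [abs_mul]
            gcongr
            have hza : z - a ≠ 0 := sub_ne_zero.2 fun h ↦ hzS.2 (h ▸ ha)
            have h1 : log ‖z - a‖ ≤ log (2 * R) := by
              refine log_le_log (norm_pos_iff.2 hza) ((norm_sub_le _ _).trans ?_)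
              linarith [hsR a ha]
            have h2 : log (2 * R) = log 2 + log R := log_mul (by norm_num) hR0.ne'
            -- Both logarithms lie below log (2R). The two gaps average to log 2 each, whence the
            -- factor 2 log 2 per zero or pole.
            have h3 := abs_log_sub_log_le h1 (y := log R) (by linarith [log_pos one_lt_two])
            linarith
      _ = _ := by
          rw [circleAverage_fun_add i2 (CircleIntegrable.fun_sum s i3),
            circleAverage_fun_sum i3, circleAverage_abs_log_norm hf, hmass, Finset.sum_mul]
          congr 1
          refine Finset.sum_congr rfl fun a ha ↦ ?_
          have := circleAverage_fun_smul (a := |d a|) (c := 0) (R := R)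
            (f := fun z ↦ log 2 + (log (2 * R) - log ‖z - a‖))
          simp only [smul_eq_mul] at this
          rw [this, circleAverage_fun_add (circleIntegrable_const _ _ _) (i1 a),
            circleAverage_fun_sub (circleIntegrable_const _ _ _)
              (circleIntegrable_log_norm_sub a R), circleAverage_const, circleAverage_const,
            circleAverage_log_norm_sub_const_of_mem_closedBall (by
              rw [abs_of_pos hR0]; simpa using hsR a ha), log_mul (by norm_num) hR0.ne']
          ring
  have j1 : ∀ a : ℂ, CircleIntegrable (fun z ↦ log (r + ‖a‖) - log ‖z - a‖) 0 r := fun a ↦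
    (circleIntegrable_const _ _ _).sub (circleIntegrable_log_norm_sub a r)
  have j2 : ∀ a : ℂ, CircleIntegrable (fun z ↦ log (r + ‖a‖) - log ‖q * z + c - a‖) 0 r := fun a ↦
    (circleIntegrable_const _ _ _).sub (circleIntegrable_log_norm_affine q c a r)
  have j3 : ∀ a ∈ s, CircleIntegrable (fun z ↦ |d a| * ((log (r + ‖a‖) - log ‖z - a‖) +
      (log (r + ‖a‖) - log ‖q * z + c - a‖))) 0 r := fun a _ ↦
    ((j1 a).add (j2 a)).const_smul (a := |d a|)
  have hinj : Function.Injective fun z : ℂ ↦ q * z + c := fun x y hxy ↦ by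
    simpa [hq] using hxy
  have hmain : circleAverage (fun z ↦ log⁺ ‖f (q * z + c) / f z‖) 0 r ≤
      circleAverage (fun z ↦ ∑ a ∈ s, |d a| * ((log (r + ‖a‖) - log ‖z - a‖) +
      (log (r + ‖a‖) - log ‖q * z + c - a‖)) + 6 * r / R * A) 0 r := by
    refine circleAverage_mono_off_finite (S := (S ∪ s) ∪ (fun z ↦ q * z + c) ⁻¹' (S ∪ s))
      ((hS.union s.finite_toSet).union ((hS.union s.finite_toSet).preimage hinj.injOn))
      hr.ne' ?_ ?_ ?_
    · refine MeromorphicOn.circleIntegrable_posLog_norm fun z _ ↦ ?_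
      refine MeromorphicAt.div ?_ (hf z)
      exact (hf (q * z + c)).comp_analyticAt (g := fun z ↦ q * z + c) (by fun_prop)
    · exact (CircleIntegrable.fun_sum s j3).add (circleIntegrable_const _ _ _)
    · intro z hz hzS
      rw [abs_of_pos hr] at hz
      have hzn : ‖z‖ = r := by simpa using hz
      have hwn : ‖q * z + c‖ ≤ r := by
        refine (norm_add_le _ _).trans ?_
        rwa [norm_mul, hzn]
      simp only [mem_union, mem_preimage, not_or, Finset.mem_coe] at hzS
      obtain ⟨⟨hz1, hz2⟩, hw1, hw2⟩ := hzS
      have ez := hlog z (by simp [hzn]; linarith) hz1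
      have ew := hlog (q * z + c) (by simp only [mem_closedBall, dist_zero_right]; linarith) hw1
      -- Both points have norm at most r, so both logarithms lie below log (r + ‖a‖). The gaps have
      -- averages at most log 2 and log (4/‖q‖).
      have hterm : ∀ a ∈ s, |log ‖q * z + c - a‖ - log ‖z - a‖| ≤
          (log (r + ‖a‖) - log ‖z - a‖) + (log (r + ‖a‖) - log ‖q * z + c - a‖) := fun a ha ↦ by
        rw [abs_sub_comm]
        refine abs_log_sub_log_le ?_ ?_
        · have hza : z - a ≠ 0 := sub_ne_zero.2 fun h ↦ hz2 (h ▸ ha)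
          refine log_le_log (norm_pos_iff.2 hza) ((norm_sub_le _ _).trans ?_)
          linarith
        · have hza : q * z + c - a ≠ 0 := sub_ne_zero.2 fun h ↦ hw2 (h ▸ ha)
          refine log_le_log (norm_pos_iff.2 hza) ((norm_sub_le _ _).trans ?_)
          linarith
      have hsum : ∑ a ∈ s, d a * (log ‖q * z + c - a‖ - log ‖z - a‖) ≤
          ∑ a ∈ s, |d a| * ((log (r + ‖a‖) - log ‖z - a‖) +
            (log (r + ‖a‖) - log ‖q * z + c - a‖)) := by
        refine Finset.sum_le_sum fun a ha ↦ ?_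
        refine (le_abs_self _).trans ?_
        rw [abs_mul]
        gcongr
        exact hterm a ha
      have hharm := harmonic_sub_le κ hr hR hu hzn.le hwn
      have hnn : 0 ≤ ∑ a ∈ s, |d a| * ((log (r + ‖a‖) - log ‖z - a‖) +
            (log (r + ‖a‖) - log ‖q * z + c - a‖)) + 6 * r / R * A :=
        add_nonneg (Finset.sum_nonneg fun a ha ↦
          mul_nonneg (abs_nonneg _) ((abs_nonneg _).trans (hterm a ha))) (by positivity)
      refine max_le hnn ?_
      -- The values of f at isolated points are arbitrary. If one of these two vanishes, the
      -- quotient is 0 and `log 0 = 0`.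
      by_cases h0 : f (q * z + c) = 0 ∨ f z = 0
      · rcases h0 with h0 | h0 <;> simpa [h0] using hnn
      · push Not at h0
        rw [norm_div, log_div (norm_ne_zero_iff.2 h0.1) (norm_ne_zero_iff.2 h0.2), ez, ew]
        simp only [mul_sub, Finset.sum_sub_distrib] at hsum
        linarith
  refine hmain.trans ?_
  rw [circleAverage_fun_add (CircleIntegrable.fun_sum s j3) (circleIntegrable_const _ _ _),
    circleAverage_const, circleAverage_fun_sum j3]
  refine add_le_add ?_ (mul_le_mul_of_nonneg_left hAle (by positivity))
  rw [hmass, Finset.sum_mul]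
  refine Finset.sum_le_sum fun a _ ↦ ?_
  have := circleAverage_fun_smul (a := |d a|) (c := 0) (R := r)
    (f := fun z ↦ (log (r + ‖a‖) - log ‖z - a‖) + (log (r + ‖a‖) - log ‖q * z + c - a‖))
  simp only [smul_eq_mul] at this
  rw [this, circleAverage_fun_add (j1 a) (j2 a),
    circleAverage_fun_sub (circleIntegrable_const _ _ _) (circleIntegrable_log_norm_sub a r),
    circleAverage_fun_sub (circleIntegrable_const _ _ _)
      (circleIntegrable_log_norm_affine q c a r), circleAverage_const]
  exact mul_le_mul_of_nonneg_left (add_le_add (circleAverage_log_sub_le hr a)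
    (circleAverage_log_affine_sub_le hq0 hq1 hr hrc a)) (abs_nonneg _)

/-! ### Counting functions as finite sums and as integrals -/

/-- The logarithmic counting function as a finite sum. -/
lemma logCounting_eq_sum (E : locallyFinsupp ℂ ℤ) {r : ℝ} (hr : 0 < r) (s : Finset ℂ)
    (hs : ∀ z ∈ s, ‖z‖ ≤ r) (hE : ∀ z, ‖z‖ ≤ r → E z ≠ 0 → z ∈ s) :
    locallyFinsuppWithin.logCounting E r = ∑ z ∈ s, (E z : ℝ) * (log r - log ‖z‖) := by
  classical
  have hmem : ∀ z : ℂ, z ∈ closedBall (0 : ℂ) |r| ↔ ‖z‖ ≤ r := fun z ↦ by simp [abs_of_pos hr]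
  have h1 : locallyFinsuppWithin.logCounting E r =
      ∑ z ∈ s, (E z : ℝ) * log (r * ‖z‖⁻¹) + E 0 * log r := by
    simp only [locallyFinsuppWithin.logCounting, AddMonoidHom.coe_mk, ZeroHom.coe_mk]
    congr 1
    rw [finsum_eq_sum_of_support_subset (s := s)]
    · refine Finset.sum_congr rfl fun z hz ↦ ?_
      rw [locallyFinsuppWithin.toClosedBall_eval_within _ ((hmem z).2 (hs z hz))]
    · intro z hz
      have hz1 : locallyFinsuppWithin.toClosedBall r E z ≠ 0 := fun h ↦ hz (by simp [h])
      have hz2 : z ∈ closedBall (0 : ℂ) |r| :=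
        locallyFinsuppWithin.toClosedBall_support_subset_closedBall E hz1
      rw [locallyFinsuppWithin.toClosedBall_eval_within _ hz2] at hz1
      exact hE z ((hmem z).1 hz2) hz1
  -- The separate term at the origin merges into the sum, because `log ‖0‖ = 0` makes log r - log
  -- ‖z‖ equal to log r there.
  have h2 : (E 0 : ℝ) * log r = ∑ z ∈ s, if z = 0 then (E 0 : ℝ) * log r else 0 := by
    rw [Finset.sum_ite_eq' s 0]
    split_ifs with h
    · rfl
    · have : E 0 = 0 := by
        by_contra h0
        exact h (hE 0 (by simpa using hr.le) h0)
      simp [this]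
  rw [h1, h2, ← Finset.sum_add_distrib]
  refine Finset.sum_congr rfl fun z _ ↦ ?_
  by_cases hz : z = 0
  · simp [hz]
  · rw [if_neg hz, log_mul hr.ne' (by simpa using hz), log_inv]
    ring

/-- The points of the support of a divisor in `|z| ≤ r`. -/
noncomputable def supportFinset (E : locallyFinsupp ℂ ℤ) (r : ℝ) : Finset ℂ :=
  (E.locallyFiniteSupport.finite_inter_support_of_isCompact
    (isCompact_closedBall (0 : ℂ) r)).toFinset

lemma mem_supportFinset {E : locallyFinsupp ℂ ℤ} {r : ℝ} {z : ℂ} :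
    z ∈ supportFinset E r ↔ ‖z‖ ≤ r ∧ E z ≠ 0 := by
  simp [supportFinset]

lemma logCounting_eq_sum_supportFinset (E : locallyFinsupp ℂ ℤ) {r : ℝ} (hr : 0 < r) :
    locallyFinsuppWithin.logCounting E r =
      ∑ z ∈ supportFinset E r, (E z : ℝ) * (log r - log ‖z‖) :=
  logCounting_eq_sum E hr _ (fun _ hz ↦ (mem_supportFinset.1 hz).1)
    fun _ h1 h2 ↦ mem_supportFinset.2 ⟨h1, h2⟩

/-- The unintegrated counting function is controlled by the integrated one at a larger radius. -/
lemma divisorMass_mul_log_le {f : ℂ → ℂ} (hf : Meromorphic f) {R K : ℝ} (hR : 1 ≤ R)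
    (hK : 1 ≤ K) :
    divisorMass f R * log K ≤
      ValueDistribution.logCounting f 0 (K * R) + ValueDistribution.logCounting f ⊤ (K * R) := by
  set D := MeromorphicOn.divisor f univ with hD
  have hR0 : 0 < R := by linarith
  have hRK : R ≤ K * R := by nlinarith
  have hE : ∀ z, (D⁺ + D⁻) z = |D z| := fun z ↦ by
    exact posPart_add_negPart (D z)
  rw [ValueDistribution.logCounting_zero, ValueDistribution.logCounting_top, ← hD,
    ← Pi.add_apply, ← map_add, logCounting_eq_sum_supportFinset _ (by positivity)]
  have hsub : supportFinset (D⁺ + D⁻) R ⊆ supportFinset (D⁺ + D⁻) (K * R) := fun z hz ↦ by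
    rw [mem_supportFinset] at hz ⊢
    exact ⟨hz.1.trans hRK, hz.2⟩
  -- Each point of |z| ≤ R weighs at least log K in the counting function at radius KR. At the
  -- origin this uses R ≥ 1.
  have hlog : ∀ z : ℂ, ‖z‖ ≤ R → log K ≤ log (K * R) - log ‖z‖ := fun z hz ↦ by
    rw [log_mul (by positivity) (by positivity)]
    rcases eq_or_ne z 0 with rfl | h0
    · simp [log_nonneg hR]
    · linarith [log_le_log (norm_pos_iff.2 h0) hz]
  have hmass : divisorMass f R = ∑ z ∈ supportFinset (D⁺ + D⁻) R, ((D⁺ + D⁻) z : ℝ) := by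
    rw [divisorMass, finsum_eq_sum_of_support_subset (s := supportFinset (D⁺ + D⁻) R)]
    · refine Finset.sum_congr rfl fun z hz ↦ ?_
      rw [hE z, MeromorphicOn.divisor_apply hf.meromorphicOn
          (by simpa using (mem_supportFinset.1 hz).1),
        hD, MeromorphicOn.divisor_apply hf.meromorphicOn (mem_univ z)]
      simp
    · intro z hz
      have hz0 : MeromorphicOn.divisor f (closedBall (0 : ℂ) R) z ≠ 0 := by simpa using hz
      have hzm : z ∈ closedBall (0 : ℂ) R :=
        (MeromorphicOn.divisor f (closedBall (0 : ℂ) R)).supportWithinDomain hz0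
      refine mem_supportFinset.2 ⟨by simpa using hzm, ?_⟩
      rw [hE z, hD, MeromorphicOn.divisor_apply hf.meromorphicOn (mem_univ z),
        ← MeromorphicOn.divisor_apply hf.meromorphicOn hzm]
      simpa using hz0
  have hpos : ∀ z, (0 : ℝ) ≤ ((D⁺ + D⁻) z : ℝ) := fun z ↦ by
    rw [hE z]; positivity
  rw [hmass, Finset.sum_mul]
  refine (Finset.sum_le_sum fun z hz ↦ ?_).trans
    (Finset.sum_le_sum_of_subset_of_nonneg hsub fun z hz _ ↦ ?_)
  · exact mul_le_mul_of_nonneg_left (hlog z (mem_supportFinset.1 hz).1) (hpos z)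
  · refine mul_nonneg (hpos z) (sub_nonneg.2 ?_)
    rcases eq_or_ne z 0 with rfl | h0
    · simpa using log_nonneg (hR.trans hRK)
    · exact log_le_log (norm_pos_iff.2 h0) (mem_supportFinset.1 hz).1

/-- `∫ t in 0..r, 1[ρ ≤ t] / t = log r - log ρ`. -/
lemma integral_indicator_div {ρ r : ℝ} (hρ : 0 < ρ) (hρr : ρ ≤ r) :
    IntervalIntegrable (fun t ↦ (Ici ρ).indicator (fun t ↦ t⁻¹) t) MeasureTheory.volume 0 r ∧
    ∫ t in (0 : ℝ)..r, (Ici ρ).indicator (fun t ↦ t⁻¹) t = log r - log ρ := by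
  have hr : 0 < r := hρ.trans_le hρr
  have e0 : ∀ t ∈ Ioo (0 : ℝ) ρ, (0 : ℝ) = (Ici ρ).indicator (fun t ↦ t⁻¹) t := fun t ht ↦ by
    rw [indicator_of_notMem]
    simpa using ht.2
  have e1 : ∀ t ∈ Icc ρ r, t⁻¹ = (Ici ρ).indicator (fun t ↦ t⁻¹) t := fun t ht ↦ by
    rw [indicator_of_mem]
    exact ht.1
  have i0 : IntervalIntegrable (fun t ↦ (Ici ρ).indicator (fun t ↦ t⁻¹) t)
      MeasureTheory.volume 0 ρ := by
    refine (intervalIntegrable_const (c := (0 : ℝ))).congr_uIoo ?_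
    rw [uIoo_of_le hρ.le]
    exact e0
  have i1' : IntervalIntegrable (fun t : ℝ ↦ t⁻¹) MeasureTheory.volume ρ r := by
    refine intervalIntegral.intervalIntegrable_inv (fun t ht ↦ ?_) continuousOn_id
    rw [uIcc_of_le hρr] at ht
    exact (hρ.trans_le ht.1).ne'
  have i1 : IntervalIntegrable (fun t ↦ (Ici ρ).indicator (fun t ↦ t⁻¹) t)
      MeasureTheory.volume ρ r := by
    refine i1'.congr_uIoo ?_
    rw [uIoo_of_le hρr]
    exact fun t ht ↦ e1 t ⟨ht.1.le, ht.2.le⟩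
  refine ⟨i0.trans i1, ?_⟩
  rw [← intervalIntegral.integral_add_adjacent_intervals i0 i1]
  have a0 : ∫ t in (0 : ℝ)..ρ, (Ici ρ).indicator (fun t ↦ t⁻¹) t = 0 := by
    rw [intervalIntegral.integral_congr_uIoo (g := fun _ ↦ (0 : ℝ))]
    · simp
    · rw [uIoo_of_le hρ.le]
      exact fun t ht ↦ (e0 t ht).symm
  have a1 : ∫ t in ρ..r, (Ici ρ).indicator (fun t ↦ t⁻¹) t = log r - log ρ := by
    rw [intervalIntegral.integral_congr (g := fun t ↦ t⁻¹), integral_inv_of_pos hρ hr,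
      log_div hr.ne' hρ.ne']
    rw [uIcc_of_le hρr]
    exact fun t ht ↦ (e1 t ht).symm
  rw [a0, a1, zero_add]

/-- The integral form of the logarithmic counting function. -/
lemma integral_count_eq_logCounting {m : ℂ → ℕ} (E : locallyFinsupp ℂ ℤ)
    (hE : ∀ z, E z = m z) {r : ℝ} (hr : 0 < r) :
    (∫ t in (0 : ℝ)..r, (((∑ᶠ z ∈ closedBall (0 : ℂ) t, m z : ℕ) : ℝ) -
        ((∑ᶠ z ∈ closedBall (0 : ℂ) 0, m z : ℕ) : ℝ)) / t) +
      ((∑ᶠ z ∈ closedBall (0 : ℂ) 0, m z : ℕ) : ℝ) * log r =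
    locallyFinsuppWithin.logCounting E r := by
  classical
  set s := supportFinset E r with hs
  have hms : ∀ z, m z ≠ 0 → ‖z‖ ≤ r → z ∈ s := fun z hz hzr ↦
    mem_supportFinset.2 ⟨hzr, by rw [hE]; exact_mod_cast hz⟩
  have hcount : ∀ t ≤ r, ((∑ᶠ z ∈ closedBall (0 : ℂ) t, m z : ℕ) : ℝ) =
      ∑ z ∈ s, if ‖z‖ ≤ t then (m z : ℝ) else 0 := by
    intro t ht
    rw [finsum_mem_eq_sum_of_inter_support_eq m (t := s.filter fun z ↦ ‖z‖ ≤ t),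
      Finset.sum_filter]
    · push_cast
      rfl
    · ext z
      simp only [mem_inter_iff, mem_closedBall, dist_zero_right, mem_support, Finset.coe_filter,
        mem_ofPred_eq]
      exact ⟨fun h ↦ ⟨⟨hms z h.2 (h.1.trans ht), h.1⟩, h.2⟩, fun h ↦ ⟨h.1.2, h.2⟩⟩
  have hzero : ∀ z : ℂ, ‖z‖ ≤ (0 : ℝ) ↔ z = 0 := fun z ↦ norm_le_zero_iff
  have hsr : ∀ z ∈ s, ‖z‖ ≤ r := fun z hz ↦ (mem_supportFinset.1 hz).1
  have hint : ∀ z ∈ s, IntervalIntegrable (fun t ↦ (m z : ℝ) *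
        (if z = 0 then 0 else (Ici ‖z‖).indicator (fun t ↦ t⁻¹) t)) MeasureTheory.volume 0 r ∧
      ∫ t in (0 : ℝ)..r, (m z : ℝ) *
        (if z = 0 then 0 else (Ici ‖z‖).indicator (fun t ↦ t⁻¹) t) =
      (m z : ℝ) * (if z = 0 then 0 else log r - log ‖z‖) := fun z hz ↦ by
    by_cases h0 : z = 0
    · simp [h0]
    · have := integral_indicator_div (norm_pos_iff.2 h0) (hsr z hz)
      simp only [h0, if_false]
      refine ⟨this.1.const_mul _, ?_⟩
      rw [intervalIntegral.integral_const_mul, this.2]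
  -- Expand n(t) - n(0) into indicators of ‖z‖ ≤ t over the finite support. The origin drops out and
  -- returns through the term with log r.
  have hI : (∫ t in (0 : ℝ)..r, (((∑ᶠ z ∈ closedBall (0 : ℂ) t, m z : ℕ) : ℝ) -
        ((∑ᶠ z ∈ closedBall (0 : ℂ) 0, m z : ℕ) : ℝ)) / t) =
      ∑ z ∈ s, (m z : ℝ) * (if z = 0 then 0 else log r - log ‖z‖) := by
    rw [← Finset.sum_congr rfl fun z hz ↦ (hint z hz).2,
      ← intervalIntegral.integral_finsetSum fun z hz ↦ (hint z hz).1]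
    refine intervalIntegral.integral_congr_uIoo fun t ht ↦ ?_
    rw [uIoo_of_le hr.le] at ht
    rw [hcount t ht.2.le, hcount 0 hr.le, ← Finset.sum_sub_distrib, Finset.sum_div]
    refine Finset.sum_congr rfl fun z _ ↦ ?_
    by_cases h0 : z = 0
    · simp [h0, ht.1.le]
    · by_cases h1 : ‖z‖ ≤ t
      · simp [h0, h1, div_eq_mul_inv]
      · simp [h0, h1]
  rw [hI, hcount 0 hr.le, Finset.sum_mul, ← Finset.sum_add_distrib,
    logCounting_eq_sum_supportFinset E hr]
  refine Finset.sum_congr rfl fun z _ ↦ ?_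
  rw [hE z]
  by_cases h0 : z = 0
  · simp [h0]
  · simp [h0]

/-! ### The Hahn difference, its divisor, and the poles of the shifted function -/

variable {q c : ℂ} {g : ℂ → ℂ}

lemma meromorphic_sub_const (hg : Meromorphic g) (b : ℂ) : Meromorphic fun z ↦ g z - b :=
  fun z ↦ (hg z).sub (MeromorphicAt.const b z)

/-- By the identity theorem, infinite order at one point propagates to all points, so g would be the
constant b off a closed discrete set. -/
lemma meromorphicOrderAt_sub_const_ne_top (hg : Meromorphic g)
    (hconst : ¬ IsConstantMeromorphic g) (b z : ℂ) :
    meromorphicOrderAt (fun z ↦ g z - b) z ≠ ⊤ := by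
  intro hz
  have hm := meromorphic_sub_const hg b
  have hall : ∀ w, meromorphicOrderAt (fun z ↦ g z - b) w = ⊤ := by
    by_contra hcon
    push Not at hcon
    exact hm.exists_meromorphicOrderAt_ne_top_iff_forall.1 hcon z hz
  refine hconst ⟨b, ?_⟩
  refine mem_codiscreteWithin_iff_forall_mem_nhdsNE.2 fun w _ ↦ ?_
  filter_upwards [meromorphicOrderAt_eq_top_iff.1 (hall w)] with x hx
  exact Or.inl (sub_eq_zero.1 hx)

lemma meromorphicOrderAt_ne_top (hg : Meromorphic g)
    (hconst : ¬ IsConstantMeromorphic g) (z : ℂ) : meromorphicOrderAt g z ≠ ⊤ := by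
  simpa using meromorphicOrderAt_sub_const_ne_top hg hconst 0 z

lemma meromorphic_comp_affine (hg : Meromorphic g) (q c : ℂ) :
    Meromorphic fun z ↦ g (q * z + c) := fun z ↦
  (hg (q * z + c)).comp_analyticAt (g := fun z ↦ q * z + c) (by fun_prop)

lemma meromorphicOrderAt_comp_affine (g : ℂ → ℂ) (hq : q ≠ 0) (c z : ℂ) :
    meromorphicOrderAt (fun z ↦ g (q * z + c)) z = meromorphicOrderAt g (q * z + c) := by
  refine meromorphicOrderAt_comp_of_deriv_ne_zero (g := fun z ↦ q * z + c) (by fun_prop) ?_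
  simpa using hq

/-- A meromorphic germ that is invariant under a contraction fixing the base point has order
zero. -/
lemma meromorphicOrderAt_eq_zero_of_invariant {f : ℂ → ℂ} {z₀ : ℂ} (hq0 : 0 < ‖q‖)
    (hq1 : ‖q‖ < 1) (hz₀ : q * z₀ + c = z₀) (hf : MeromorphicAt f z₀)
    (hne : meromorphicOrderAt f z₀ ≠ ⊤) (hinv : ∀ᶠ z in 𝓝[≠] z₀, f (q * z + c) = f z) :
    meromorphicOrderAt f z₀ = 0 := by
  have hq : q ≠ 0 := norm_pos_iff.1 hq0
  obtain ⟨k, hk⟩ := WithTop.ne_top_iff_exists.1 hne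
  obtain ⟨h, h1, h2, h3⟩ := (meromorphicOrderAt_eq_int_iff hf).1 hk.symm
  have hσ0 : Tendsto (fun z ↦ q * z + c) (𝓝 z₀) (𝓝 z₀) := by
    have : Continuous fun z : ℂ ↦ q * z + c := by fun_prop
    simpa [hz₀] using this.tendsto z₀
  have hsub : ∀ z, q * z + c - z₀ = q * (z - z₀) := fun z ↦ by linear_combination hz₀
  have hσ : Tendsto (fun z ↦ q * z + c) (𝓝[≠] z₀) (𝓝[≠] z₀) := by
    refine tendsto_nhdsWithin_iff.2 ⟨hσ0.mono_left nhdsWithin_le_nhds, ?_⟩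
    filter_upwards [self_mem_nhdsWithin] with z hz
    have hz' : z - z₀ ≠ 0 := sub_ne_zero.2 hz
    exact sub_ne_zero.1 (by rw [hsub]; exact mul_ne_zero hq hz')
  have heq : ∀ᶠ z in 𝓝[≠] z₀, q ^ k * h (q * z + c) = h z := by
    filter_upwards [h3, hσ.eventually h3, hinv, self_mem_nhdsWithin] with z e1 e2 e3 hz
    have hz' : z - z₀ ≠ 0 := sub_ne_zero.2 hz
    rw [e1, e2, hsub, mul_zpow] at e3
    simp only [smul_eq_mul] at e3
    have := zpow_ne_zero k hz'
    apply mul_left_cancel₀ this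
    linear_combination e3
  have l1 : Tendsto (fun z ↦ q ^ k * h (q * z + c)) (𝓝[≠] z₀) (𝓝 (q ^ k * h z₀)) :=
    (h1.continuousAt.tendsto.comp (hσ0.mono_left nhdsWithin_le_nhds)).const_mul _
  have l2 : Tendsto h (𝓝[≠] z₀) (𝓝 (h z₀)) :=
    h1.continuousAt.tendsto.mono_left nhdsWithin_le_nhds
  -- Comparing leading coefficients at the fixed point gives q^k = 1, so k = 0 because 0 < ‖q‖ < 1.
  have l3 := tendsto_nhds_unique (l1.congr' heq) l2
  have hqk : q ^ k = 1 := by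
    apply mul_right_cancel₀ h2
    rw [l3, one_mul]
  have hk0 : k = 0 := by
    have : ‖q‖ ^ k = 1 := by rw [← norm_zpow, hqk, norm_one]
    exact (zpow_eq_one_iff_right₀ hq0.le hq1.ne).1 this
  rw [← hk, hk0]
  rfl

lemma meromorphic_hahnDiff (hg : Meromorphic g) (q c : ℂ) : Meromorphic (hahnDiff q c g) :=
  fun z ↦ ((meromorphic_comp_affine hg q c z).sub (hg z)).div (by fun_prop)

/-- The Hahn difference of a nonconstant meromorphic function does not vanish identically. -/
lemma meromorphicOrderAt_hahnDiff_ne_top (hq0 : 0 < ‖q‖) (hq1 : ‖q‖ < 1) (hg : Meromorphic g)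
    (hconst : ¬ IsConstantMeromorphic g) (z : ℂ) :
    meromorphicOrderAt (hahnDiff q c g) z ≠ ⊤ := by
  have hm := meromorphic_hahnDiff hg q c
  have hq1' : q - 1 ≠ 0 := sub_ne_zero.2 fun h ↦ by simp [h] at hq1
  set z₀ : ℂ := -c / (q - 1) with hz₀def
  have hz₀ : q * z₀ + c = z₀ := by
    rw [hz₀def]; field_simp; ring
  refine hm.exists_meromorphicOrderAt_ne_top_iff_forall.1 ⟨z₀, fun htop ↦ ?_⟩ z
  have hinv : ∀ᶠ w in 𝓝[≠] z₀, g (q * w + c) = g w := by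
    filter_upwards [meromorphicOrderAt_eq_top_iff.1 htop, self_mem_nhdsWithin] with w hw hw0
    have hw0' : w - z₀ ≠ 0 := sub_ne_zero.2 hw0
    have hlin : (q - 1) * w + c ≠ 0 := by
      have : (q - 1) * w + c = (q - 1) * (w - z₀) := by linear_combination hz₀
      rw [this]
      exact mul_ne_zero hq1' hw0'
    rw [hahnDiff, div_eq_zero_iff] at hw
    exact sub_eq_zero.1 (hw.resolve_right hlin)
  have h0 : meromorphicOrderAt g z₀ = 0 := meromorphicOrderAt_eq_zero_of_invariant hq0 hq1 hz₀
    (hg z₀) (meromorphicOrderAt_ne_top hg hconst z₀) hinv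
  obtain ⟨b, hb⟩ := tendsto_nhds_of_meromorphicOrderAt_nonneg (hg z₀) h0.ge
  -- With b the limit of g at the fixed point, g - b is invariant too and has order 0, yet it tends
  -- to 0: a contradiction.
  have hb0 : meromorphicOrderAt (fun z ↦ g z - b) z₀ = 0 :=
    meromorphicOrderAt_eq_zero_of_invariant hq0 hq1 hz₀ (meromorphic_sub_const hg b z₀)
    (meromorphicOrderAt_sub_const_ne_top hg hconst b z₀) (by
      filter_upwards [hinv] with w hw
      rw [hw])
  have hb1 : Tendsto (fun z ↦ g z - b) (𝓝[≠] z₀) (𝓝 0) := by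
    simpa using hb.sub_const b
  rw [tendsto_zero_iff_meromorphicOrderAt_pos (meromorphic_sub_const hg b z₀), hb0] at hb1
  exact lt_irrefl _ hb1

/-- The divisor counted by the Hahn-type counting function of a finite value `b`. -/
noncomputable def hahnDivisor (q c : ℂ) (g : ℂ → ℂ) (b : ℂ) : locallyFinsupp ℂ ℤ :=
  (MeromorphicOn.divisor (fun z ↦ g z - b) univ)⁺ -
    (MeromorphicOn.divisor (fun z ↦ g z - b) univ)⁺ ⊓ (MeromorphicOn.divisor (hahnDiff q c g) univ)⁺

lemma hahnDivisor_apply (hq0 : 0 < ‖q‖) (hq1 : ‖q‖ < 1) (hg : Meromorphic g)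
    (hconst : ¬ IsConstantMeromorphic g) (b z : ℂ) :
    hahnDivisor q c g b z = hahnMult q c g (b : WithTop ℂ) z := by
  obtain ⟨k, hk⟩ := WithTop.ne_top_iff_exists.1 (meromorphicOrderAt_sub_const_ne_top hg hconst b z)
  obtain ⟨l, hl⟩ := WithTop.ne_top_iff_exists.1
    (meromorphicOrderAt_hahnDiff_ne_top (c := c) hq0 hq1 hg hconst z)
  have h1 : zeroMult (fun z ↦ g z - b) z = (k.toNat : ℕ∞) := by
    rw [zeroMult, ← hk]; rfl
  have h2 : zeroMult (hahnDiff q c g) z = (l.toNat : ℕ∞) := by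
    rw [zeroMult, ← hl]; rfl
  have h3 : hahnMult q c g (b : WithTop ℂ) z = k.toNat - min k.toNat l.toNat := by
    change reducedMult (fun z ↦ g z - b) (hahnDiff q c g) z = _
    rw [reducedMult, h1, h2]
    norm_cast
  have h4 : MeromorphicOn.divisor (fun z ↦ g z - b) univ z = k := by
    rw [MeromorphicOn.divisor_apply (meromorphic_sub_const hg b).meromorphicOn (mem_univ z), ← hk]
    rfl
  have h5 : MeromorphicOn.divisor (hahnDiff q c g) univ z = l := by
    rw [MeromorphicOn.divisor_apply (meromorphic_hahnDiff hg q c).meromorphicOn (mem_univ z), ← hl]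
    rfl
  have h6 : hahnDivisor q c g b z = k⁺ - min k⁺ l⁺ := by
    rw [← h4, ← h5]
    rfl
  rw [h6, h3, posPart_def, posPart_def]
  simp only [max_def, min_def]
  split_ifs <;> omega

lemma hahnLogCount_eq (hq0 : 0 < ‖q‖) (hq1 : ‖q‖ < 1) (hg : Meromorphic g)
    (hconst : ¬ IsConstantMeromorphic g) (b : ℂ) {r : ℝ} (hr : 0 < r) :
    hahnLogCount q c g (b : WithTop ℂ) r =
      locallyFinsuppWithin.logCounting (hahnDivisor q c g b) r :=
  integral_count_eq_logCounting _ (hahnDivisor_apply hq0 hq1 hg hconst b) hr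

/-- The counting functions of the zeros of `g - b`, for finitely many `b`, reduced by the zeros of
the Hahn difference. -/
lemma sum_logCounting_sub_le (hg : Meromorphic g) (s : Finset ℂ) {r : ℝ} (hr : 1 ≤ r) :
    ∑ b ∈ s, ValueDistribution.logCounting (fun z ↦ g z - b) 0 r -
      ValueDistribution.logCounting (hahnDiff q c g) 0 r ≤
    ∑ b ∈ s, locallyFinsuppWithin.logCounting (hahnDivisor q c g b) r := by
  simp only [ValueDistribution.logCounting_zero]
  rw [← Finset.sum_apply, ← Finset.sum_apply, ← map_sum, ← map_sum, ← Pi.sub_apply, ← map_sub]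
  refine locallyFinsuppWithin.logCounting_le ?_ hr
  rw [locallyFinsuppWithin.le_def]
  intro z
  set B := MeromorphicOn.divisor (hahnDiff q c g) univ with hB
  set A := fun b ↦ MeromorphicOn.divisor (fun z ↦ g z - b) univ with hA
  have e1 : (∑ b ∈ s, (A b)⁺ - B⁺) z = ∑ b ∈ s, (A b z)⁺ - (B z)⁺ := by
    simp
  have e2 : (∑ b ∈ s, hahnDivisor q c g b) z = ∑ b ∈ s, ((A b z)⁺ - min (A b z)⁺ (B z)⁺) := by
    rw [locallyFinsuppWithin.coe_sum, Finset.sum_apply]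
    rfl
  change (∑ b ∈ s, (A b)⁺ - B⁺) z ≤ (∑ b ∈ s, hahnDivisor q c g b) z
  rw [e1, e2, Finset.sum_sub_distrib]
  -- Limits are unique, so at z at most one g - b has a zero and at most one summand is nonzero. The
  -- zeros of the Hahn difference are therefore spent only once.
  have key : ∑ b ∈ s, min (A b z)⁺ (B z)⁺ ≤ (B z)⁺ := by
    by_cases h : ∃ b ∈ s, 0 < A b z
    · obtain ⟨b, hb, hbz⟩ := h
      rw [Finset.sum_eq_single_of_mem b hb]
      · exact min_le_right _ _
      · intro b' _ hne
        have : A b' z ≤ 0 := by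
          by_contra hpos
          push Not at hpos
          have t : ∀ b, 0 < A b z → Tendsto (fun z ↦ g z - b) (𝓝[≠] z) (𝓝 0) := fun b hb ↦ by
            rw [tendsto_zero_iff_meromorphicOrderAt_pos (meromorphic_sub_const hg b z)]
            rw [hA, MeromorphicOn.divisor_apply (meromorphic_sub_const hg b).meromorphicOn
              (mem_univ z)] at hb
            cases ho : meromorphicOrderAt (fun z ↦ g z - b) z with
            | top => simp
            | coe k =>
              rw [ho] at hb
              exact_mod_cast hb
          have := tendsto_nhds_unique ((t b hbz).sub (t b' hpos))
            (tendsto_const_nhds (x := b' - b) |>.congr fun z ↦ by ring)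
          rw [sub_zero] at this
          exact hne (sub_eq_zero.1 this.symm)
        rw [posPart_eq_zero.2 this]
        exact min_eq_left (posPart_nonneg _)
    · push Not at h
      rw [Finset.sum_eq_zero fun b hb ↦ ?_]
      · exact posPart_nonneg _
      · rw [posPart_eq_zero.2 (h b hb)]
        exact min_eq_left (posPart_nonneg _)
  linarith

/-- The counting function of the poles of `g (q z + c)`. -/
lemma exists_logCounting_comp_affine_le (hq0 : 0 < ‖q‖) (hq1 : ‖q‖ < 1) (hg : Meromorphic g) :
    ∃ C : ℝ, ∀ r : ℝ, 1 ≤ r → ‖q‖ * r + ‖c‖ ≤ r →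
      ValueDistribution.logCounting (fun z ↦ g (q * z + c)) ⊤ r ≤
        ValueDistribution.logCounting g ⊤ r + C := by
  classical
  have hq : q ≠ 0 := norm_pos_iff.1 hq0
  set E : locallyFinsupp ℂ ℤ := (MeromorphicOn.divisor g univ)⁻ with hE
  set E' : locallyFinsupp ℂ ℤ := (MeromorphicOn.divisor (fun z ↦ g (q * z + c)) univ)⁻ with hE'
  have hEE : ∀ z, E' z = E (q * z + c) := fun z ↦ by
    rw [hE, hE', locallyFinsuppWithin.negPart_apply, locallyFinsuppWithin.negPart_apply,
      MeromorphicOn.divisor_apply (meromorphic_comp_affine hg q c).meromorphicOn (mem_univ z),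
      MeromorphicOn.divisor_apply hg.meromorphicOn (mem_univ _),
      meromorphicOrderAt_comp_affine g hq]
  have hE0 : ∀ z, (0 : ℝ) ≤ (E z : ℝ) := fun z ↦ by
    have : 0 ≤ E z := by
      rw [hE, locallyFinsuppWithin.negPart_apply]; exact negPart_nonneg _
    exact_mod_cast this
  set t₀ : ℝ := ‖c‖ / (1 - ‖q‖) with ht₀
  have hq1' : 0 < 1 - ‖q‖ := by linarith
  -- If b = qz + c and ‖b‖ > t₀, then ‖b‖ ≤ ‖z‖, so the pole z of the shifted function weighs no
  -- more than b. The finitely many other poles are paid for by χ, independently of r.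
  set χ : ℂ → ℝ := fun b ↦ if ‖b‖ ≤ t₀ then |log ‖b‖ - log ‖(b - c) / q‖| else 0 with hχ
  have hχ0 : ∀ b, 0 ≤ χ b := fun b ↦ by
    simp only [hχ]; split_ifs <;> positivity
  refine ⟨∑ b ∈ supportFinset E t₀, (E b : ℝ) * χ b, fun r hr hrq ↦ ?_⟩
  have hr0 : 0 < r := by linarith
  have hinj : Function.Injective fun z : ℂ ↦ q * z + c := fun x y hxy ↦ by
    simpa [hq] using hxy
  rw [ValueDistribution.logCounting_top, ValueDistribution.logCounting_top, ← hE, ← hE',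
    logCounting_eq_sum_supportFinset E' hr0, logCounting_eq_sum_supportFinset E hr0]
  have hterm : ∀ z : ℂ, log r - log ‖z‖ ≤ log r - log ‖q * z + c‖ + χ (q * z + c) := fun z ↦ by
    have hz : (q * z + c - c) / q = z := by field_simp; ring
    simp only [hχ, hz]
    split_ifs with h
    · linarith [le_abs_self (log ‖q * z + c‖ - log ‖z‖)]
    · push Not at h
      have h0 : 0 < ‖q * z + c‖ := lt_of_le_of_lt (by positivity) h
      rw [ht₀, div_lt_iff₀ hq1'] at h
      have h1 : ‖q * z + c‖ ≤ ‖q‖ * ‖z‖ + ‖c‖ := (norm_add_le _ _).trans_eq (by rw [norm_mul])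
      have h2 : ‖q * z + c‖ ≤ ‖z‖ := by
        by_contra hcon
        push Not at hcon
        nlinarith
      linarith [log_le_log h0 h2]
  have hmem : ∀ z ∈ supportFinset E' r, q * z + c ∈ supportFinset E r := fun z hz ↦ by
    rw [mem_supportFinset] at hz ⊢
    rw [hEE] at hz
    refine ⟨(norm_add_le _ _).trans ?_, hz.2⟩
    rw [norm_mul]
    nlinarith [hz.1, norm_nonneg q]
  have hnn : ∀ b ∈ supportFinset E r, 0 ≤ log r - log ‖b‖ := fun b hb ↦ by
    rcases eq_or_ne b 0 with rfl | h0
    · simpa using log_nonneg hr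
    · exact sub_nonneg.2 (log_le_log (norm_pos_iff.2 h0) (mem_supportFinset.1 hb).1)
  calc ∑ z ∈ supportFinset E' r, (E' z : ℝ) * (log r - log ‖z‖)
      ≤ ∑ z ∈ supportFinset E' r, (E (q * z + c) : ℝ) *
          (log r - log ‖q * z + c‖ + χ (q * z + c)) := by
        refine Finset.sum_le_sum fun z _ ↦ ?_
        rw [hEE]
        exact mul_le_mul_of_nonneg_left (hterm z) (hE0 _)
    _ = ∑ b ∈ (supportFinset E' r).image fun z ↦ q * z + c, (E b : ℝ) *
          (log r - log ‖b‖ + χ b) := by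
        rw [Finset.sum_image hinj.injOn]
    _ ≤ ∑ b ∈ supportFinset E r, (E b : ℝ) * (log r - log ‖b‖ + χ b) := by
        refine Finset.sum_le_sum_of_subset_of_nonneg (Finset.image_subset_iff.2 hmem)
          fun b hb _ ↦ mul_nonneg (hE0 b) (add_nonneg (hnn b hb) (hχ0 b))
    _ = ∑ b ∈ supportFinset E r, (E b : ℝ) * (log r - log ‖b‖) +
          ∑ b ∈ supportFinset E r, (E b : ℝ) * χ b := by
        rw [← Finset.sum_add_distrib]
        exact Finset.sum_congr rfl fun _ _ ↦ by ring
    _ ≤ _ := by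
        refine add_le_add le_rfl ?_
        rw [← Finset.sum_filter_add_sum_filter_not _ fun b ↦ ‖b‖ ≤ t₀]
        have h2 : ∑ b ∈ supportFinset E r with ¬ ‖b‖ ≤ t₀, (E b : ℝ) * χ b = 0 :=
          Finset.sum_eq_zero fun b hb ↦ by
            simp only [hχ, if_neg (Finset.mem_filter.1 hb).2, mul_zero]
        rw [h2, add_zero]
        refine Finset.sum_le_sum_of_subset_of_nonneg (fun b hb ↦ ?_)
          fun b _ _ ↦ mul_nonneg (hE0 b) (hχ0 b)
        rw [Finset.mem_filter, mem_supportFinset] at hb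
        exact mem_supportFinset.2 ⟨hb.2, hb.1.2⟩

/-! ### First main theorem and growth of the characteristic -/

open ValueDistribution

lemma eventually_ne_zero_codiscrete {f : ℂ → ℂ} (hf : Meromorphic f)
    (hne : ∀ z, meromorphicOrderAt f z ≠ ⊤) : ∀ᶠ z in codiscrete ℂ, f z ≠ 0 := by
  refine mem_codiscreteWithin_iff_forall_mem_nhdsNE.2 fun w _ ↦ ?_
  filter_upwards [(meromorphicOrderAt_ne_top_iff_eventually_ne_zero (hf w)).1 (hne w)] with x hx
  exact Or.inl hx

lemma finite_zeros_closedBall {f : ℂ → ℂ} (hf : Meromorphic f)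
    (hne : ∀ z, meromorphicOrderAt f z ≠ ⊤) (R : ℝ) :
    {z ∈ closedBall (0 : ℂ) R | f z = 0}.Finite := by
  have h := (isCompact_closedBall (0 : ℂ) R).finite_sdiff_of_mem_codiscreteWithin
    (codiscreteWithin_mono (subset_univ _) (eventually_ne_zero_codiscrete hf hne))
  refine h.subset fun z hz ↦ ⟨hz.1, fun h0 ↦ h0 hz.2⟩

/-- The first main theorem for a finite value. -/
lemma exists_abs_characteristic_sub_le (hg : Meromorphic g) (a : ℂ) :
    ∃ C : ℝ, ∀ r : ℝ,
      |characteristic g ⊤ r - characteristic (fun z ↦ g z - a) ⊤ r| ≤ C ∧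
      |characteristic g ⊤ r - (proximity (fun z ↦ g z - a)⁻¹ ⊤ r +
        logCounting (fun z ↦ g z - a) 0 r)| ≤ C := by
  refine ⟨(log⁺ ‖a‖ + log 2) + max |log ‖(fun z ↦ g z - a) 0‖|
    |log ‖meromorphicTrailingCoeffAt (fun z ↦ g z - a) 0‖|, fun r ↦ ?_⟩
  have h1 := abs_characteristic_sub_characteristic_shift_le (a₀ := a) (r := r) hg
  have h2 := characteristic_sub_characteristic_inv_le (R := r) (meromorphic_sub_const hg a)
  have h3 : characteristic (fun z ↦ g z - a)⁻¹ ⊤ r = proximity (fun z ↦ g z - a)⁻¹ ⊤ r +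
        logCounting (fun z ↦ g z - a) 0 r := by
    rw [characteristic, Pi.add_apply, logCounting_inv]
  constructor
  · exact h1.trans (le_add_of_nonneg_right ((abs_nonneg _).trans (le_max_left _ _)))
  · rw [← h3]
    exact (abs_sub_le _ _ _).trans (add_le_add h1 h2)

lemma proximity_le_characteristic (f : ℂ → ℂ) {r : ℝ} (hr : 1 ≤ r) :
    proximity f ⊤ r ≤ characteristic f ⊤ r := by
  rw [characteristic, Pi.add_apply]
  linarith [logCounting_nonneg (f := f) (e := ⊤) hr]

lemma logCounting_le_characteristic (f : ℂ → ℂ) (r : ℝ) :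
    logCounting f ⊤ r ≤ characteristic f ⊤ r := by
  rw [characteristic, Pi.add_apply]
  have : 0 ≤ proximity f ⊤ r := proximity_nonneg r
  linarith

/-- The characteristic function of a nonconstant meromorphic function grows at least like
`log r`. -/
lemma exists_log_le_characteristic (hg : Meromorphic g) (hconst : ¬ IsConstantMeromorphic g) :
    ∃ C r₀ : ℝ, ∀ r : ℝ, r₀ ≤ r → log r ≤ characteristic g ⊤ r + C := by
  classical
  obtain ⟨z₁, hz₁⟩ := (hg 0).eventually_analyticAt.exists
  -- With b attained at a point of analyticity, the zero of g - b at z₁ alone contributes log r -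
  -- log ‖z₁‖.
  set b := g z₁ with hb
  obtain ⟨C, hC⟩ := exists_abs_characteristic_sub_le hg b
  refine ⟨C + log ‖z₁‖, max 1 ‖z₁‖, fun r hr ↦ ?_⟩
  have hr1 : 1 ≤ r := (le_max_left _ _).trans hr
  have han : AnalyticAt ℂ (fun z ↦ g z - b) z₁ := hz₁.sub analyticAt_const
  have hpos : 0 < meromorphicOrderAt (fun z ↦ g z - b) z₁ := by
    rw [← tendsto_zero_iff_meromorphicOrderAt_pos han.meromorphicAt]
    simpa [hb] using han.continuousAt.tendsto.mono_left nhdsWithin_le_nhds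
  have hD : locallyFinsuppWithin.single z₁ (1 : ℤ) ≤
      (MeromorphicOn.divisor (fun z ↦ g z - b) univ)⁺ := by
    rw [locallyFinsuppWithin.le_def]
    intro z
    rw [locallyFinsuppWithin.posPart_apply, locallyFinsuppWithin.single_apply]
    split_ifs with h
    · subst h
      obtain ⟨k, hk⟩ := WithTop.ne_top_iff_exists.1
        (meromorphicOrderAt_sub_const_ne_top hg hconst b z)
      rw [MeromorphicOn.divisor_apply (meromorphic_sub_const hg b).meromorphicOn (mem_univ z), ← hk]
      rw [← hk] at hpos
      have : 0 < k := by exact_mod_cast hpos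
      exact le_trans this (le_posPart k)
    · exact posPart_nonneg _
  have h1 := locallyFinsuppWithin.logCounting_le hD hr1
  rw [locallyFinsuppWithin.logCounting_single_eq_log_sub_const ((le_max_right _ _).trans hr),
    ← logCounting_zero] at h1
  have h2 := (abs_le.1 (hC r).2).1
  have h3 := proximity_nonneg (f := (fun z ↦ g z - b)⁻¹) (a := ⊤) r
  simp only [Pi.zero_apply, Int.cast_one, one_mul] at h3 h1
  linarith

lemma tendsto_characteristic_atTop (hg : Meromorphic g) (hconst : ¬ IsConstantMeromorphic g) :
    Tendsto (characteristic g ⊤) atTop atTop := by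
  obtain ⟨C, r₀, h⟩ := exists_log_le_characteristic hg hconst
  refine tendsto_atTop_mono' (f₁ := fun r ↦ log r + -C) atTop ?_
    (tendsto_atTop_add_const_right _ _ tendsto_log_atTop)
  filter_upwards [eventually_ge_atTop r₀] with r hr
  linarith [h r hr]

/-- A function of order zero does not grow by a factor `2` under dilations of the radius, for
arbitrarily large radii. -/
lemma exists_characteristic_mul_le (hg : Meromorphic g) (hconst : ¬ IsConstantMeromorphic g)
    (hord : growthOrder g = 0) {K : ℝ} (hK : 1 < K) (r₀ : ℝ) :
    ∃ r, r₀ ≤ r ∧ characteristic g ⊤ (K * r) ≤ 2 * characteristic g ⊤ r := by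
  by_contra hcon
  push Not at hcon
  obtain ⟨r₁, hr₁, hr₁0, hT⟩ := ((eventually_ge_atTop (max r₀ 2)).and
    ((eventually_ge_atTop (1 : ℝ)).and
    ((tendsto_characteristic_atTop hg hconst).eventually_ge_atTop 1))).exists
  have hr₁2 : 2 ≤ r₁ := (le_max_right _ _).trans hr₁
  -- If doubling always occurred beyond r₀, T would grow at least like a power with exponent log 2 /
  -- log K. Half this exponent is the ε that contradicts order zero.
  have hgrow : ∀ n : ℕ, 2 ^ n ≤ characteristic g ⊤ (K ^ n * r₁) := by
    intro n
    induction n with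
    | zero => simpa using hT
    | succ n ih =>
      have h1 : r₀ ≤ K ^ n * r₁ := by
        have : r₀ ≤ r₁ := (le_max_left _ _).trans hr₁
        nlinarith [one_le_pow₀ hK.le (n := n)]
      have := hcon _ h1
      rw [show K ^ (n + 1) * r₁ = K * (K ^ n * r₁) by ring, pow_succ]
      linarith
  have hlogK := log_pos hK
  have hlog2 := log_pos one_lt_two
  set ε := log 2 / (2 * log K) with hε
  have hε0 : 0 < ε := by positivity
  have hlim : limsup (fun r : ℝ ↦ ((Real.posLog (nevT g r) / Real.log r : ℝ) : EReal)) atTop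
      < (ε : EReal) := by
    rw [growthOrder] at hord
    rw [hord]
    exact_mod_cast hε0
  have hev := eventually_lt_of_limsup_lt hlim
  have htend : Tendsto (fun n : ℕ ↦ K ^ n * r₁) atTop atTop :=
    (tendsto_pow_atTop_atTop_of_one_lt hK).atTop_mul_const (by linarith)
  obtain ⟨n, hn, hn2⟩ := ((htend.eventually hev).and
    (((tendsto_natCast_atTop_atTop (R := ℝ)).atTop_mul_const (half_pos hlog2)).eventually_gt_atTop
      (ε * log r₁))).exists
  have hn' : log⁺ (nevT g (K ^ n * r₁)) / log (K ^ n * r₁) < ε := by exact_mod_cast hn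
  have hKn : 1 ≤ K ^ n := one_le_pow₀ hK.le
  have hlogr : 0 < log (K ^ n * r₁) := log_pos (by nlinarith)
  rw [div_lt_iff₀ hlogr, log_mul (by positivity) (by positivity), log_pow] at hn'
  have h1 : (n : ℝ) * log 2 ≤ log⁺ (nevT g (K ^ n * r₁)) := by
    rw [← log_pow]
    refine (log_le_log (by positivity) (hgrow n)).trans ?_
    exact le_max_right _ _
  have h2 : ε * ((n : ℝ) * log K + log r₁) = n * (log 2 / 2) + ε * log r₁ := by
    rw [hε]; field_simp
  rw [h2] at hn'
  linarith

/-! ### Small proximity functions and the characteristic of the Hahn difference -/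

/-- The quotient of `g (q z + c) - a` by `g z - a` has small proximity function. -/
lemma exists_proximity_shift_le (hq0 : 0 < ‖q‖) (hq1 : ‖q‖ < 1) (hg : Meromorphic g)
    (hconst : ¬ IsConstantMeromorphic g) (c : ℂ) {ε : ℝ} (hε : 0 < ε) :
    ∃ K : ℝ, 1 < K ∧ ∀ a : ℂ, ∃ C r₀ : ℝ, ∀ r : ℝ, r₀ ≤ r →
      circleAverage (fun z ↦ log⁺ ‖(g (q * z + c) - a) / (g z - a)‖) 0 r ≤
        ε * characteristic g ⊤ (K * r) + C := by
  set L := log 2 + log (4 / ‖q‖) with hL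
  have hL0 : 0 ≤ L := by
    have : 1 ≤ 4 / ‖q‖ := by rw [le_div_iff₀ hq0]; linarith
    have := log_nonneg this
    have := log_pos one_lt_two
    positivity
  have hcoef : Tendsto (fun k : ℝ ↦ 2 * (L / log k + 6 / k * (1 + 2 * log 2 / log k)))
      atTop (𝓝 0) := by
    have t1 : Tendsto (fun k : ℝ ↦ L / log k) atTop (𝓝 0) :=
      tendsto_const_nhds.div_atTop tendsto_log_atTop
    have t2 : Tendsto (fun k : ℝ ↦ 2 * log 2 / log k) atTop (𝓝 0) :=
      tendsto_const_nhds.div_atTop tendsto_log_atTop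
    have t3 : Tendsto (fun k : ℝ ↦ 6 / k) atTop (𝓝 0) :=
      tendsto_const_nhds.div_atTop tendsto_id
    simpa using (t1.add (t3.mul (t2.const_add 1))).const_mul 2
  obtain ⟨k, hk, hk2⟩ := ((hcoef.eventually (ge_mem_nhds hε)).and (eventually_ge_atTop 2)).exists
  have hk0 : 0 < k := by linarith
  have hlogk : 0 < log k := log_pos (by linarith)
  -- One factor k is the ratio R/r in the shift estimate, the other bounds the number of zeros and
  -- poles in |z| ≤ R. It depends on ε and q but not on a, so one K serves all values.
  refine ⟨k * k, by nlinarith, fun a ↦ ?_⟩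
  obtain ⟨C, hC⟩ := exists_abs_characteristic_sub_le hg a
  set f : ℂ → ℂ := fun z ↦ g z - a with hf
  have hfm : Meromorphic f := meromorphic_sub_const hg a
  have hq1' : 0 < 1 - ‖q‖ := by linarith
  refine ⟨(L / log k + 6 / k * (1 + 2 * log 2 / log k)) * (2 * C),
    max 1 (max (2 * ‖c‖) (‖c‖ / (1 - ‖q‖))), fun r hr ↦ ?_⟩
  have hr1 : 1 ≤ r := (le_max_left _ _).trans hr
  have hrc : 2 * ‖c‖ ≤ r := ((le_max_left _ _).trans (le_max_right _ _)).trans hr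
  have hrq : ‖q‖ * r + ‖c‖ ≤ r := by
    have : ‖c‖ / (1 - ‖q‖) ≤ r := ((le_max_right _ _).trans (le_max_right _ _)).trans hr
    rw [div_le_iff₀ hq1'] at this
    linarith
  have hr0 : 0 < r := by linarith
  have hkr : 1 ≤ k * r := by nlinarith
  have hkkr : 1 ≤ k * (k * r) := by nlinarith
  have key := proximity_shift_quotient_le hfm (meromorphicOrderAt_sub_const_ne_top hg hconst a)
    hq0 hq1 hr0 hrc hrq (R := k * r) (by nlinarith)
  set T := characteristic g ⊤ (k * (k * r)) with hT
  set X := 2 * T + 2 * C with hX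
  have hmass : divisorMass f (k * r) ≤ X / log k := by
    rw [le_div_iff₀ hlogk]
    refine (divisorMass_mul_log_le hfm hkr (by linarith)).trans ?_
    have h1 := (abs_le.1 (hC (k * (k * r))).1).1
    have h2 := (abs_le.1 (hC (k * (k * r))).2).1
    have h3 := proximity_nonneg (f := f⁻¹) (a := ⊤) (k * (k * r))
    have h4 := logCounting_le_characteristic f (k * (k * r))
    simp only [Pi.zero_apply] at h3
    linarith
  have hprox : proximity f ⊤ (k * r) + proximity f⁻¹ ⊤ (k * r) ≤ X := by
    have hmono : characteristic g ⊤ (k * r) ≤ T :=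
      characteristic_monotoneOn hg (by simp; positivity) (by simp; positivity) (by nlinarith)
    have h1 := (abs_le.1 (hC (k * r)).1).1
    have h2 := (abs_le.1 (hC (k * r)).2).1
    have h3 := logCounting_nonneg (f := f) (e := 0) hkr
    have h4 := proximity_le_characteristic f hkr
    linarith
  refine key.trans ?_
  have e1 : 6 * r / (k * r) = 6 / k := by field_simp
  rw [e1, ← hL]
  have hT0 : 0 ≤ T := characteristic_nonneg hkkr
  have hlog2 : 0 < log 2 := log_pos one_lt_two
  calc divisorMass f (k * r) * L + 6 / k * (proximity f ⊤ (k * r) + proximity f⁻¹ ⊤ (k * r) +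
        divisorMass f (k * r) * (2 * log 2))
      ≤ X / log k * L + 6 / k * (X + X / log k * (2 * log 2)) := by gcongr
    _ = 2 * (L / log k + 6 / k * (1 + 2 * log 2 / log k)) * T +
        (L / log k + 6 / k * (1 + 2 * log 2 / log k)) * (2 * C) := by
        rw [hX]; ring
    _ ≤ ε * T + (L / log k + 6 / k * (1 + 2 * log 2 / log k)) * (2 * C) := by gcongr
    _ = _ := by rw [hT, mul_assoc k k r]

/-- A point can be close to at most one of finitely many values. -/
lemma exists_sum_posLog_inv_le (s : Finset ℂ) :
    ∃ C : ℝ, ∀ x d : ℂ, d ≠ 0 → ∑ a ∈ s, log⁺ ‖(x - a)⁻¹‖ ≤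
      log⁺ ‖d⁻¹‖ + ∑ a ∈ s, log⁺ ‖d / (x - a)‖ + C := by
  classical
  -- With separation 2δ, a point within δ of one value is at distance at least δ from the others,
  -- which contribute O(1).
  obtain ⟨δ, hδ, hsep⟩ : ∃ δ > 0, ∀ a ∈ s, ∀ b ∈ s, a ≠ b → 2 * δ ≤ ‖a - b‖ := by
    by_cases h : s.offDiag.Nonempty
    · obtain ⟨p, hp, hmin⟩ := Finset.exists_min_image s.offDiag (fun p ↦ ‖p.1 - p.2‖) h
      rw [Finset.mem_offDiag] at hp
      refine ⟨‖p.1 - p.2‖ / 2, half_pos (norm_pos_iff.2 (sub_ne_zero.2 hp.2.2)),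
        fun a ha b hb hab ↦ ?_⟩
      have := hmin (a, b) (Finset.mem_offDiag.2 ⟨ha, hb, hab⟩)
      simp only at this
      linarith
    · refine ⟨1, one_pos, fun a ha b hb hab ↦ (h ⟨(a, b), ?_⟩).elim⟩
      exact Finset.mem_offDiag.2 ⟨ha, hb, hab⟩
  have hfar : ∀ x a : ℂ, δ ≤ ‖x - a‖ → log⁺ ‖(x - a)⁻¹‖ ≤ log⁺ δ⁻¹ := fun x a h ↦ by
    rw [norm_inv]
    exact posLog_le_posLog (by positivity) (by gcongr)
  refine ⟨s.card * log⁺ δ⁻¹, fun x d hd ↦ ?_⟩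
  have hp0 : 0 ≤ log⁺ ‖d⁻¹‖ := posLog_nonneg
  have hs0 : 0 ≤ ∑ a ∈ s, log⁺ ‖d / (x - a)‖ := Finset.sum_nonneg fun _ _ ↦ posLog_nonneg
  by_cases h : ∃ a ∈ s, ‖x - a‖ < δ
  · obtain ⟨a, ha, hxa⟩ := h
    rw [← Finset.add_sum_erase s _ ha]
    have h1 : log⁺ ‖(x - a)⁻¹‖ ≤ log⁺ ‖d⁻¹‖ + log⁺ ‖d / (x - a)‖ := by
      have : (x - a)⁻¹ = d⁻¹ * (d / (x - a)) := by field_simp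
      rw [this, norm_mul]
      exact posLog_mul
    have h2 : log⁺ ‖d / (x - a)‖ ≤ ∑ a ∈ s, log⁺ ‖d / (x - a)‖ :=
      Finset.single_le_sum (f := fun a ↦ log⁺ ‖d / (x - a)‖) (fun _ _ ↦ posLog_nonneg) ha
    have h3 : ∑ b ∈ s.erase a, log⁺ ‖(x - b)⁻¹‖ ≤ s.card * log⁺ δ⁻¹ := by
      refine (Finset.sum_le_card_nsmul _ _ (log⁺ δ⁻¹) fun b hb ↦ hfar x b ?_).trans ?_
      · have hb' := Finset.mem_erase.1 hb
        have h4 := hsep a ha b hb'.2 (Ne.symm hb'.1)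
        have h5 : ‖a - b‖ ≤ ‖x - a‖ + ‖x - b‖ := by
          rw [norm_sub_rev x a]
          exact (norm_sub_le_norm_sub_add_norm_sub a x b)
        linarith
      · rw [nsmul_eq_mul]
        have : 0 ≤ log⁺ δ⁻¹ := posLog_nonneg
        gcongr
        exact Finset.erase_subset _ _
    linarith
  · push Not at h
    have h3 : ∑ b ∈ s, log⁺ ‖(x - b)⁻¹‖ ≤ s.card * log⁺ δ⁻¹ := by
      simpa using Finset.sum_le_card_nsmul s _ (log⁺ δ⁻¹) fun b hb ↦ hfar x b (h b hb)
    linarith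

/-- An affine function has no poles and grows at most linearly, and inversion changes the
characteristic by O(1). This is the cost of the denominator of the Hahn difference. -/
lemma exists_characteristic_affine_inv_le (m c : ℂ) :
    ∃ C : ℝ, ∀ r : ℝ, 1 ≤ r → characteristic (fun z ↦ m * z + c)⁻¹ ⊤ r ≤ log r + C := by
  have han : AnalyticOn ℂ (fun z ↦ m * z + c) univ := fun z _ ↦ by
    have : AnalyticAt ℂ (fun z ↦ m * z + c) z := by fun_prop
    exact this.analyticWithinAt
  have hmero : Meromorphic (fun z ↦ m * z + c) := fun z ↦ by fun_prop
  have hN : logCounting (fun z ↦ m * z + c) ⊤ = 0 := by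
    have := logCounting_add_analyticOn (f := fun _ : ℂ ↦ (0 : ℂ)) (Meromorphic.const 0) han
    rw [logCounting_const] at this
    rw [← this]
    congr 1
    ext z
    simp
  refine ⟨log (‖m‖ + ‖c‖ + 1) + max |log ‖(fun z ↦ m * z + c) 0‖|
    |log ‖meromorphicTrailingCoeffAt (fun z ↦ m * z + c) 0‖|, fun r hr ↦ ?_⟩
  have hr0 : 0 < r := by linarith
  have h1 := (abs_le.1 (characteristic_sub_characteristic_inv_le (R := r) hmero)).1
  have h2 : characteristic (fun z ↦ m * z + c) ⊤ r ≤ log r + log (‖m‖ + ‖c‖ + 1) := by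
    rw [characteristic, hN, add_zero, proximity_top]
    refine circleAverage_mono_on_of_le_circle hmero.meromorphicOn.circleIntegrable_posLog_norm
      fun z hz ↦ ?_
    have hzn : ‖z‖ = r := by simpa [abs_of_pos hr0] using hz
    have hm := norm_nonneg m
    have hc := norm_nonneg c
    rw [← log_mul hr0.ne' (by positivity), ← posLog_eq_log (x := r * (‖m‖ + ‖c‖ + 1))]
    · refine posLog_le_posLog (norm_nonneg _) ((norm_add_le _ _).trans ?_)
      rw [norm_mul, hzn]
      nlinarith
    · rw [abs_of_pos (by positivity)]
      nlinarith
  linarith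

/-- The characteristic function of `g (q z + c)`. -/
lemma exists_characteristic_comp_affine_le (hq0 : 0 < ‖q‖) (hq1 : ‖q‖ < 1) (hg : Meromorphic g)
    (hconst : ¬ IsConstantMeromorphic g) (c : ℂ) :
    ∃ C r₀ : ℝ, ∀ r : ℝ, r₀ ≤ r → characteristic (fun z ↦ g (q * z + c)) ⊤ r ≤
      characteristic g ⊤ r +
        circleAverage (fun z ↦ log⁺ ‖(g (q * z + c) - 0) / (g z - 0)‖) 0 r + C := by
  obtain ⟨C, hC⟩ := exists_logCounting_comp_affine_le (c := c) hq0 hq1 hg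
  have hq1' : 0 < 1 - ‖q‖ := by linarith
  refine ⟨C, max 1 (‖c‖ / (1 - ‖q‖)), fun r hr ↦ ?_⟩
  have hr1 : 1 ≤ r := (le_max_left _ _).trans hr
  have hrq : ‖q‖ * r + ‖c‖ ≤ r := by
    have : ‖c‖ / (1 - ‖q‖) ≤ r := (le_max_right _ _).trans hr
    rw [div_le_iff₀ hq1'] at this
    linarith
  have hN := hC r hr1 hrq
  have hgc := meromorphic_comp_affine hg q c
  have hm : proximity (fun z ↦ g (q * z + c)) ⊤ r ≤
      proximity (fun z ↦ g (q * z + c) / g z) ⊤ r + proximity g ⊤ r := by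
    have e : (fun z ↦ g (q * z + c)) =ᶠ[codiscrete ℂ] (fun z ↦ g (q * z + c) / g z) * g := by
      filter_upwards [eventually_ne_zero_codiscrete hg (meromorphicOrderAt_ne_top hg hconst)]
        with z hz
      simp [hz]
    rw [proximity_congr_codiscrete e (by linarith)]
    exact proximity_mul_top_le (fun z ↦ (hgc z).div (hg z)) hg r
  -- Subtracting 0 in the statement makes the quotient the case a = 0 of
  -- `exists_proximity_shift_le`.
  simp only [sub_zero]
  rw [proximity_top (f := fun z ↦ g (q * z + c) / g z)] at hm
  simp only [characteristic, Pi.add_apply]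
  linarith

lemma characteristic_neg_le (hg : Meromorphic g) (hne : ∀ z, meromorphicOrderAt g z ≠ ⊤) {r : ℝ}
    (hr : 1 ≤ r) : characteristic (-g) ⊤ r ≤ characteristic g ⊤ r := by
  have h := characteristic_mul_top_le (f₁ := fun _ : ℂ ↦ (-1 : ℂ)) hr (Meromorphic.const _)
    (fun z ↦ by simp [meromorphicOrderAt_const]) hg hne
  have e : (fun _ : ℂ ↦ (-1 : ℂ)) * g = -g := by ext z; simp
  rw [e] at h
  simpa [characteristic] using h

/-- The characteristic function of the Hahn difference. -/
lemma exists_characteristic_hahnDiff_le (hq0 : 0 < ‖q‖) (hq1 : ‖q‖ < 1) (hg : Meromorphic g)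
    (hconst : ¬ IsConstantMeromorphic g) (c : ℂ) :
    ∃ C r₀ : ℝ, ∀ r : ℝ, r₀ ≤ r → characteristic (hahnDiff q c g) ⊤ r ≤
      3 * characteristic g ⊤ r +
        circleAverage (fun z ↦ log⁺ ‖(g (q * z + c) - 0) / (g z - 0)‖) 0 r + C := by
  obtain ⟨C₁, r₁, h₁⟩ := exists_characteristic_comp_affine_le hq0 hq1 hg hconst c
  obtain ⟨C₂, h₂⟩ := exists_characteristic_affine_inv_le (q - 1) c
  obtain ⟨C₃, r₃, h₃⟩ := exists_log_le_characteristic hg hconst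
  refine ⟨C₁ + C₂ + C₃ + log 2, max 1 (max r₁ r₃), fun r hr ↦ ?_⟩
  have hr1 : 1 ≤ r := (le_max_left _ _).trans hr
  have hgc := meromorphic_comp_affine hg q c
  set num : ℂ → ℂ := (fun z ↦ g (q * z + c)) + -g with hnum
  set lin : ℂ → ℂ := fun z ↦ (q - 1) * z + c with hlin
  have hnumM : Meromorphic num := hgc.add hg.neg
  have hlinM : Meromorphic lin⁻¹ := fun z ↦ by
    have : MeromorphicAt lin z := by fun_prop
    exact this.inv
  have e : hahnDiff q c g = num * lin⁻¹ := by
    ext z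
    simp [hahnDiff, hnum, hlin, div_eq_mul_inv, sub_eq_add_neg]
  have hord : ∀ z, meromorphicOrderAt num z ≠ ⊤ ∧ meromorphicOrderAt lin⁻¹ z ≠ ⊤ := fun z ↦ by
    have := meromorphicOrderAt_hahnDiff_ne_top (c := c) hq0 hq1 hg hconst z
    rw [e, meromorphicOrderAt_mul (hnumM z) (hlinM z)] at this
    exact WithTop.add_ne_top.1 this
  -- The coefficient 3 collects one T each from the shifted function, from -g, and from log r ≤ T +
  -- O(1) for the denominator.
  have k1 := characteristic_mul_top_le hr1 hnumM (fun z ↦ (hord z).1) hlinM (fun z ↦ (hord z).2)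
  have k2 := characteristic_add_top_le hgc hg.neg hr1
  have k3 := characteristic_neg_le hg (meromorphicOrderAt_ne_top hg hconst) hr1
  have k4 := h₁ r (((le_max_left _ _).trans (le_max_right _ _)).trans hr)
  have k5 := h₂ r hr1
  have k6 := h₃ r (((le_max_right _ _).trans (le_max_right _ _)).trans hr)
  rw [e]
  rw [Pi.add_apply] at k1
  linarith

/-- The proximity function of `D_{q,c} g / (g - a)` is controlled by that of the shift quotient. -/
lemma exists_proximity_hahnDiff_div_le (hq1 : ‖q‖ < 1) (hg : Meromorphic g) (c a : ℂ) :
    ∃ r₀ : ℝ, ∀ r : ℝ, r₀ ≤ r →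
      circleAverage (fun z ↦ log⁺ ‖hahnDiff q c g z / (g z - a)‖) 0 r ≤
        circleAverage (fun z ↦ log⁺ ‖(g (q * z + c) - a) / (g z - a)‖) 0 r + log 2 := by
  have hq1' : 0 < ‖q - 1‖ := norm_pos_iff.2 (sub_ne_zero.2 fun h ↦ by simp [h] at hq1)
  refine ⟨max 1 ((1 + ‖c‖) / ‖q - 1‖), fun r hr ↦ ?_⟩
  have hr1 : 1 ≤ r := (le_max_left _ _).trans hr
  have hr0 : 0 < r := by linarith
  have hrl : 1 + ‖c‖ ≤ r * ‖q - 1‖ := (div_le_iff₀ hq1').1 ((le_max_right _ _).trans hr)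
  have i : CircleIntegrable (fun z ↦ log⁺ ‖(g (q * z + c) - a) / (g z - a)‖) 0 r :=
    MeromorphicOn.circleIntegrable_posLog_norm fun z _ ↦
      ((meromorphic_comp_affine hg q c z).sub (MeromorphicAt.const a z)).div
        (meromorphic_sub_const hg a z)
  rw [← circleAverage_const (log 2) 0 r, ← circleAverage_fun_add i (circleIntegrable_const _ _ _)]
  refine circleAverage_mono ?_ (i.add (circleIntegrable_const _ _ _)) fun z hz ↦ ?_
  · exact MeromorphicOn.circleIntegrable_posLog_norm fun z _ ↦
      (meromorphic_hahnDiff hg q c z).div (meromorphic_sub_const hg a z)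
  · have hzn : ‖z‖ = r := by simpa [abs_of_pos hr0] using hz
    by_cases h0 : g z - a = 0
    · simp only [h0, div_zero, norm_zero, posLog_zero, zero_add]
      exact (log_pos one_lt_two).le
    -- The radius r₀ was chosen so that on the circle division by (q - 1)z + c does not increase the
    -- norm.
    have hlin : 1 ≤ ‖(q - 1) * z + c‖ := by
      have h := norm_sub_le_norm_add ((q - 1) * z) c
      rw [norm_mul, hzn] at h
      linarith
    have e : hahnDiff q c g z / (g z - a) =
        ((g (q * z + c) - a) / (g z - a) + -1) / ((q - 1) * z + c) := by
      rw [hahnDiff, div_add' _ _ _ h0, div_div, div_div, mul_comm (g z - a)]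
      congr 1
      ring
    have hle : ‖hahnDiff q c g z / (g z - a)‖ ≤ ‖(g (q * z + c) - a) / (g z - a) + -1‖ := by
      rw [e, norm_div]
      exact div_le_self (norm_nonneg _) hlin
    refine (posLog_le_posLog (norm_nonneg _) hle).trans ?_
    have := posLog_norm_add_le ((g (q * z + c) - a) / (g z - a)) (-1)
    simpa [add_comm] using this

/-! ### Second main theorem and countability -/

/-- The second main theorem for the Hahn difference operator, with a non-optimal constant and
an error term at a larger radius. -/
theorem exists_sum_characteristic_sub_hahnLogCount_le (hq0 : 0 < ‖q‖) (hq1 : ‖q‖ < 1)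
    (hg : Meromorphic g) (hconst : ¬ IsConstantMeromorphic g) (c : ℂ) {ε : ℝ} (hε : 0 < ε)
    (s : Finset ℂ) :
    ∃ K : ℝ, 1 < K ∧ ∃ C r₀ : ℝ, ∀ r : ℝ, r₀ ≤ r →
      ∑ a ∈ s, (characteristic g ⊤ r - hahnLogCount q c g (a : WithTop ℂ) r) ≤
        3 * characteristic g ⊤ r + (s.card + 1) * ε * characteristic g ⊤ (K * r) + C := by
  obtain ⟨K, hK, hshift⟩ := exists_proximity_shift_le hq0 hq1 hg hconst c hε
  choose Cs rs hs using hshift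
  choose Cf hf using exists_abs_characteristic_sub_le hg
  choose rd hd using fun a ↦ exists_proximity_hahnDiff_div_le hq1 hg c a
  obtain ⟨CΔ, rΔ, hΔ⟩ := exists_characteristic_hahnDiff_le hq0 hq1 hg hconst c
  obtain ⟨Cp, hp⟩ := exists_sum_posLog_inv_le s
  have hDM := meromorphic_hahnDiff hg q c
  have hDne := fun z ↦ meromorphicOrderAt_hahnDiff_ne_top (c := c) hq0 hq1 hg hconst z
  set Δ := hahnDiff q c g with hΔdef
  obtain ⟨CI, hI⟩ : ∃ C : ℝ, ∀ r : ℝ,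
      proximity Δ⁻¹ ⊤ r + logCounting Δ 0 r ≤ characteristic Δ ⊤ r + C := by
    refine ⟨max |log ‖Δ 0‖| |log ‖meromorphicTrailingCoeffAt Δ 0‖|, fun r ↦ ?_⟩
    have h1 := (abs_le.1 (characteristic_sub_characteristic_inv_le (R := r) hDM)).1
    have h2 : characteristic Δ⁻¹ ⊤ r = proximity Δ⁻¹ ⊤ r + logCounting Δ 0 r := by
      rw [characteristic, Pi.add_apply, logCounting_inv]
    rw [← h2]
    linarith
  refine ⟨K, hK, ∑ a ∈ s, Cf a + ∑ a ∈ s, (Cs a + log 2) + Cs 0 + CΔ + CI + Cp, ?_⟩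
  have hev : ∀ᶠ r : ℝ in atTop, (∀ a ∈ s, rs a ≤ r ∧ rd a ≤ r) ∧ rs 0 ≤ r ∧ rΔ ≤ r ∧ 1 ≤ r := by
    refine ((Finset.eventually_all s).2 fun a _ ↦ ?_).and ?_
    · exact (eventually_ge_atTop _).and (eventually_ge_atTop _)
    · exact (eventually_ge_atTop _).and ((eventually_ge_atTop _).and (eventually_ge_atTop _))
  obtain ⟨r₀, hr₀⟩ := eventually_atTop.1 hev
  refine ⟨r₀, fun r hr ↦ ?_⟩
  obtain ⟨h1, h2, h3, h4⟩ := hr₀ r hr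
  have hr0 : 0 < r := by linarith
  have ii : ∀ a ∈ s, CircleIntegrable (fun z ↦ log⁺ ‖(g z - a)⁻¹‖) 0 r := fun a _ ↦
    MeromorphicOn.circleIntegrable_posLog_norm fun z _ ↦ (meromorphic_sub_const hg a z).inv
  have id : ∀ a ∈ s, CircleIntegrable (fun z ↦ log⁺ ‖Δ z / (g z - a)‖) 0 r := fun a _ ↦
    MeromorphicOn.circleIntegrable_posLog_norm fun z _ ↦ (hDM z).div (meromorphic_sub_const hg a z)
  have iD : CircleIntegrable (fun z ↦ log⁺ ‖(Δ z)⁻¹‖) 0 r :=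
    MeromorphicOn.circleIntegrable_posLog_norm fun z _ ↦ (hDM z).inv
  have iDs : CircleIntegrable
      (fun z ↦ log⁺ ‖(Δ z)⁻¹‖ + ∑ a ∈ s, log⁺ ‖Δ z / (g z - a)‖) 0 r :=
    iD.add (CircleIntegrable.fun_sum s id)
  have hprox : ∑ a ∈ s, proximity (fun z ↦ g z - a)⁻¹ ⊤ r ≤ proximity Δ⁻¹ ⊤ r +
      ∑ a ∈ s, circleAverage (fun z ↦ log⁺ ‖Δ z / (g z - a)‖) 0 r + Cp := by
    simp only [proximity_top, Pi.inv_apply]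
    rw [← circleAverage_fun_sum ii, ← circleAverage_fun_sum id,
      ← circleAverage_fun_add iD (CircleIntegrable.fun_sum s id)]
    conv_rhs => rw [← circleAverage_const Cp 0 r]
    rw [← circleAverage_fun_add iDs (circleIntegrable_const _ _ _)]
    refine circleAverage_mono_off_finite (finite_zeros_closedBall hDM hDne r) hr0.ne'
      (CircleIntegrable.fun_sum s ii) (iDs.add (circleIntegrable_const _ _ _)) fun z hz hzS ↦ ?_
    refine hp (g z) (Δ z) fun h0 ↦ hzS ⟨?_, h0⟩
    rw [abs_of_pos hr0] at hz
    exact sphere_subset_closedBall hz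
  have hquot : ∑ a ∈ s, circleAverage (fun z ↦ log⁺ ‖Δ z / (g z - a)‖) 0 r ≤
      s.card * (ε * characteristic g ⊤ (K * r)) + ∑ a ∈ s, (Cs a + log 2) := by
    rw [← nsmul_eq_mul, ← Finset.sum_const, ← Finset.sum_add_distrib]
    refine Finset.sum_le_sum fun a ha ↦ ?_
    have := hd a r (h1 a ha).2
    have := hs a r (h1 a ha).1
    linarith
  have hcount := sum_logCounting_sub_le (q := q) (c := c) hg s h4
  have hhahn : ∑ a ∈ s, hahnLogCount q c g (a : WithTop ℂ) r =
      ∑ a ∈ s, locallyFinsuppWithin.logCounting (hahnDivisor q c g a) r :=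
    Finset.sum_congr rfl fun a _ ↦ hahnLogCount_eq hq0 hq1 hg hconst a hr0
  have hfmt : ∑ a ∈ s, characteristic g ⊤ r ≤ ∑ a ∈ s, proximity (fun z ↦ g z - a)⁻¹ ⊤ r +
      ∑ a ∈ s, logCounting (fun z ↦ g z - a) 0 r + ∑ a ∈ s, Cf a := by
    rw [← Finset.sum_add_distrib, ← Finset.sum_add_distrib]
    refine Finset.sum_le_sum fun a _ ↦ ?_
    linarith [(abs_le.1 (hf a r).2).2]
  -- N(r, 1/Δ) cancels between `hcount` and the first main theorem for Δ. The factor card + 1 counts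
  -- the quotients for a ∈ s and the one with a = 0 that bounds T(r, Δ).
  rw [Finset.sum_sub_distrib, hhahn]
  have k1 := hI r
  have k2 := hΔ r h3
  have k3 := hs 0 r h2
  linarith

/-- Only finitely many finite values can have a reduced counting function bounded by a fixed
proportion, less than one, of the characteristic function. -/
theorem finite_setOf_hahnLogCount_le (hq0 : 0 < ‖q‖) (hq1 : ‖q‖ < 1)
    (hg : Meromorphic g) (hconst : ¬ IsConstantMeromorphic g) (hord : growthOrder g = 0) (c : ℂ)
    {η : ℝ} (hη : 0 < η) :
    {a : ℂ | ∀ᶠ r : ℝ in atTop, hahnLogCount q c g (a : WithTop ℂ) r ≤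
      (1 - η) * characteristic g ⊤ r}.Finite := by
  by_contra hinf
  obtain ⟨p, hp⟩ := exists_nat_gt (6 / η)
  rw [div_lt_iff₀ hη] at hp
  obtain ⟨s, hsub, hcard⟩ := Set.Infinite.exists_subset_card_eq hinf p
  have hp1 : (0 : ℝ) < p + 1 := by positivity
  -- This ε turns the error term into T(Kr)/2 ≤ T(r). As also C < T(r), the right side is below
  -- 5T(r), while the left side is at least pηT(r) > 6T(r).
  obtain ⟨K, hK, C, r₀, hmain⟩ := exists_sum_characteristic_sub_hahnLogCount_le hq0 hq1 hg hconst c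
    (ε := 1 / (2 * (p + 1))) (by positivity) s
  have hev : ∀ᶠ r : ℝ in atTop, (∀ a ∈ s, hahnLogCount q c g (a : WithTop ℂ) r ≤
      (1 - η) * characteristic g ⊤ r) ∧ C < characteristic g ⊤ r ∧ 0 < characteristic g ⊤ r ∧
      r₀ ≤ r :=
    ((Finset.eventually_all s).2 fun a ha ↦ hsub ha).and
      (((tendsto_characteristic_atTop hg hconst).eventually_gt_atTop C).and
      (((tendsto_characteristic_atTop hg hconst).eventually_gt_atTop 0).and
        (eventually_ge_atTop r₀)))
  obtain ⟨r₁, hr₁⟩ := eventually_atTop.1 hev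
  obtain ⟨r, hr, hTK⟩ := exists_characteristic_mul_le hg hconst hord hK r₁
  obtain ⟨h1, h2, h3, h4⟩ := hr₁ r hr
  have hm := hmain r h4
  have hlow : p * (η * characteristic g ⊤ r) ≤
      ∑ a ∈ s, (characteristic g ⊤ r - hahnLogCount q c g (a : WithTop ℂ) r) := by
    rw [← hcard, ← nsmul_eq_mul]
    refine Finset.card_nsmul_le_sum _ _ _ fun a ha ↦ ?_
    linarith [h1 a ha]
  have hhalf : (s.card + 1) * (1 / (2 * (p + 1))) * characteristic g ⊤ (K * r) =
      characteristic g ⊤ (K * r) / 2 := by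
    rw [hcard]; field_simp
  rw [hhalf] at hm
  nlinarith

/-- A deficient finite value has reduced counting function at most a fixed proportion of the
characteristic function. -/
lemma IsHahnDeficient.exists_eventually_le (hg : Meromorphic g)
    (hconst : ¬ IsConstantMeromorphic g) {a : WithTop ℂ} (ha : IsHahnDeficient q c g a) :
    ∃ n : ℕ, ∀ᶠ r : ℝ in atTop, hahnLogCount q c g a r ≤
      (1 - 1 / ((n : ℝ) + 1)) * characteristic g ⊤ r := by
  rw [IsHahnDeficient, hahnTheta] at ha
  have hlt : limsup (fun r : ℝ ↦ ((hahnLogCount q c g a r / nevT g r : ℝ) : EReal)) atTop < 1 := by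
    by_contra hcon
    push Not at hcon
    have : (1 : EReal) - limsup (fun r : ℝ ↦ ((hahnLogCount q c g a r / nevT g r : ℝ) : EReal))
        atTop ≤ 1 - 1 := EReal.sub_le_sub le_rfl hcon
    rw [show (1 : EReal) - 1 = 0 by
      rw [← EReal.coe_one, ← EReal.coe_sub]; simp] at this
    exact absurd ha (not_lt.2 this)
  obtain ⟨y, hy1, hy2⟩ := EReal.lt_iff_exists_real_btwn.1 hlt
  have hy : 0 < 1 - y := by
    have : y < 1 := by exact_mod_cast hy2
    linarith
  obtain ⟨n, hn⟩ := exists_nat_one_div_lt hy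
  refine ⟨n, ?_⟩
  filter_upwards [eventually_lt_of_limsup_lt hy1,
    (tendsto_characteristic_atTop hg hconst).eventually_gt_atTop 0] with r hr hT
  have hr' : hahnLogCount q c g a r / nevT g r < y := by exact_mod_cast hr
  rw [nevT, div_lt_iff₀ hT] at hr'
  nlinarith

end HahnNevanlinna

theorem mainTheorem6 (q c : ℂ) (hq0 : 0 < ‖q‖) (hq1 : ‖q‖ < 1)
    (g : ℂ → ℂ) (hg : Meromorphic g) (hconst : ¬ HahnNevanlinna.IsConstantMeromorphic g)
    (hord : HahnNevanlinna.growthOrder g = 0) :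
    {a : WithTop ℂ | HahnNevanlinna.IsHahnDeficient q c g a}.Countable := by
  have hfin : ∀ n : ℕ, {a : ℂ | ∀ᶠ r : ℝ in Filter.atTop,
      HahnNevanlinna.hahnLogCount q c g (a : WithTop ℂ) r ≤
        (1 - 1 / ((n : ℝ) + 1)) * ValueDistribution.characteristic g ⊤ r}.Finite := fun n ↦
    HahnNevanlinna.finite_setOf_hahnLogCount_le hq0 hq1 hg hconst hord c (by positivity)
  -- The value ∞ needs no analysis: one point does not affect countability.
  refine ((Set.countable_singleton ⊤).union
    (Set.countable_iUnion fun n ↦ (hfin n).countable.image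
      (fun a : ℂ ↦ (a : WithTop ℂ)))).mono fun a ha ↦ ?_
  obtain ⟨n, hn⟩ := HahnNevanlinna.IsHahnDeficient.exists_eventually_le hg hconst ha
  cases a with
  | top => exact Or.inl rfl
  | coe b => exact Or.inr (Set.mem_iUnion.2 ⟨n, b, hn, rfl⟩)
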